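/- **Theorem 3.10 (Neveu decomposition).** Let $M\subseteq\mathcal B(\mathcal H)$ be a $\sigma$-finite semifinite von Neumann algebra (i.e. $M$ carries a faithful normal semifinite trace) with predual $M_*$. Let $G$ be a locally compact, second countable, Hausdorff topological semigroup with a $\sigma$-finite Borel measure $m$ such that $m(uB)=m(B)=m(Bu)$ for all $u\in G$ and all Borel $B\subseteq G$. Let $(K_n)$ be a two-sided Følner net of measurable subsets of $G$, that is, $0<m(K_n)<\infty$ for all $n$, and $$\lim_n \frac{m(K_n\,\Delta\, K_ng)}{m(K_n)}=0=\lim_n \frac{m(K_n\,\Delta\, gK_n)}{m(K_n)}\qquad\text{for all } g\in G,$$ indexed by a directed set whose order filter is countably generated (e.g. $\mathbb N$ or $\mathbb R_+$). Let $\alpha=(\alpha_g)_{g\in G}$ be an action ($\alpha_g\alpha_h=\alpha_{gh}$) or an anti-action ($\alpha_g\alpha_h=\alpha_{hg}$) of $G$ on $M$ by normal positive linear maps with $\|\alpha_g\|\le 1$ and $\alpha_g(1)\le 1$, such that $g\mapsto\alpha_g(x)$ is weak-$*$ continuous for every $x\in M$. For $x\in M$ let $A_n(x)=\frac1{m(K_n)}\int_{K_n}\alpha_g(x)\,dm(g)$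 (weak-$*$ integral). A positive $x\in M$ is called *weakly wandering* if $\lim_n\|A_n(x)\|=0$. A functional $\rho$ on $M$ is called *$G$-invariant* if $\rho\circ\alpha_g=\rho$ for all $g\in G$. The support $s(x)$ of a positive $x\in M$ is the smallest projection $p\in M$ with $px=x$. The support $s(\rho)$ of a normal state $\rho$ is $1-p$, where $p$ is the largest projection in $M$ with $\rho(p)=0$. Then there are projections $e_1,e_2\in M$ with $e_1+e_2=1$ such that 1. there is a $G$-invariant normal state $\rho$ on $M$ with $s(\rho)=e_1$, or else $M$ has no $G$-invariant normal state and $e_1=0$; and 2. there is a weakly wandering operator $x_0\in M$ with $s(x_0)=e_2$. Moreover, the pair $(e_1,e_2)$ of projections with $e_1+e_2=1$ satisfying 1 and 2 is unique. -/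

import Mathlib

open scoped ComplexOrder NNReal ENNReal

namespace Neveu

section Algebra

variable {H : Type*} [NormedAddCommGroup H] [InnerProductSpace ℂ H] [CompleteSpace H]

/-- The algebra `M` as a type: the operators on `H` that belong to `M`, with the operator norm and
the order of operators (`0 ≤ x` if and only if `x` is a positive operator). -/
abbrev Elt (M : VonNeumannAlgebra H) : Type _ := M.toStarSubalgebra

variable {M : VonNeumannAlgebra H}

/-- A linear functional belongs to the predual `M_*`, i.e. it is continuous for the ultraweak
topology: `φ x = ∑ₙ ⟪ξₙ, x ηₙ⟫` with `∑ ‖ξₙ‖² < ∞` and `∑ ‖ηₙ‖² < ∞`. -/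
def IsNormal (φ : Elt M →ₗ[ℂ] ℂ) : Prop :=
  ∃ ξ η : ℕ → H, Summable (fun n => ‖ξ n‖ ^ 2) ∧ Summable (fun n => ‖η n‖ ^ 2) ∧
    ∀ x : Elt M, HasSum (fun n => inner ℂ (ξ n) ((x : H →L[ℂ] H) (η n))) (φ x)

/-- A normal state: a positive normal linear functional with value `1` at the identity. -/
structure IsNormalState (ρ : Elt M →ₗ[ℂ] ℂ) : Prop where
  normal : IsNormal ρ
  nonneg : ∀ x : Elt M, 0 ≤ ρ (star x * x)
  map_one : ρ 1 = 1

/-- `e = s(ρ)`: the projection `1 - e` is the largest projection on which `ρ` vanishes. -/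
def IsFunctionalSupport (ρ : Elt M →ₗ[ℂ] ℂ) (e : Elt M) : Prop :=
  IsGreatest {p : Elt M | IsStarProjection p ∧ ρ p = 0} (1 - e)

/-- `e = s(x)` for self-adjoint `x`: the smallest projection of `M` with `e x = x`. -/
def IsOperatorSupport (x e : Elt M) : Prop :=
  IsLeast {p : Elt M | IsStarProjection p ∧ p * x = x} e

/-- `M` is `σ`-finite: every family of pairwise orthogonal non-zero projections is countable. -/
def IsSigmaFinite (M : VonNeumannAlgebra H) : Prop :=
  ∀ S : Set (Elt M), (∀ p ∈ S, IsStarProjection p ∧ p ≠ 0) →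
    S.Pairwise (fun p q => p * q = 0) → S.Countable

/-- A faithful normal semifinite trace on `M`. Only the values of `τ` on positive elements are
relevant. -/
structure IsFNSTrace (τ : Elt M → ℝ≥0∞) : Prop where
  add : ∀ x y : Elt M, 0 ≤ x → 0 ≤ y → τ (x + y) = τ x + τ y
  smul : ∀ (c : ℝ≥0) (x : Elt M), 0 ≤ x → τ (((c : ℝ) : ℂ) • x) = c * τ x
  trace : ∀ x : Elt M, τ (star x * x) = τ (x * star x)
  faithful : ∀ x : Elt M, 0 ≤ x → τ x = 0 → x = 0
  normal : ∀ (D : Set (Elt M)) (x : Elt M), D.Nonempty → DirectedOn (· ≤ ·) D →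
    (∀ d ∈ D, 0 ≤ d) → IsLUB D x → τ x = ⨆ d ∈ D, τ d
  semifinite : ∀ x : Elt M, 0 ≤ x → x ≠ 0 → ∃ y : Elt M, 0 ≤ y ∧ y ≤ x ∧ y ≠ 0 ∧ τ y < ∞

/-- `M` is semifinite: it carries a faithful normal semifinite trace. -/
def IsSemifinite (M : VonNeumannAlgebra H) : Prop :=
  ∃ τ : Elt M → ℝ≥0∞, IsFNSTrace τ

end Algebra

section Semigroup

variable {G : Type*} [Semigroup G] [MeasurableSpace G]

/-- The measure is invariant under both families of translations: `m(uB) = m(B) = m(Bu)`. -/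
def IsBiinvariant (m : MeasureTheory.Measure G) : Prop :=
  ∀ (u : G) (B : Set G), MeasurableSet B →
    m ((fun h => u * h) '' B) = m B ∧ m ((fun h => h * u) '' B) = m B

/-- A two-sided Følner net `(K i)` of measurable subsets of `G`. -/
structure IsFolnerNet {ι : Type*} [Preorder ι] (m : MeasureTheory.Measure G) (K : ι → Set G) :
    Prop where
  measurable : ∀ i, MeasurableSet (K i)
  pos : ∀ i, 0 < m (K i)
  finite : ∀ i, m (K i) < ∞
  right : ∀ g : G, Filter.Tendsto
    (fun i => m (symmDiff (K i) ((fun h => h * g) '' K i)) / m (K i)) Filter.atTop (nhds 0)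
  left : ∀ g : G, Filter.Tendsto
    (fun i => m (symmDiff (K i) ((fun h => g * h) '' K i)) / m (K i)) Filter.atTop (nhds 0)

end Semigroup

section Dynamics

variable {H : Type*} [NormedAddCommGroup H] [InnerProductSpace ℂ H] [CompleteSpace H]
variable {M : VonNeumannAlgebra H} {G : Type*} [Semigroup G]

/-- A non-commutative dynamical system `(M, G, α)`: an action or an anti-action of `G` on `M` by
normal positive subunital contractions, pointwise weak-* continuous in `g`. -/
structure IsDynamicalSystem [TopologicalSpace G] (α : G → (Elt M →L[ℂ] Elt M)) : Prop where
  action : (∀ (g h : G) (x : Elt M), α g (α h x) = α (g * h) x) ∨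
    (∀ (g h : G) (x : Elt M), α g (α h x) = α (h * g) x)
  normal : ∀ (g : G) (φ : Elt M →ₗ[ℂ] ℂ), IsNormal φ → IsNormal (φ ∘ₗ (α g : Elt M →ₗ[ℂ] Elt M))
  continuous : ∀ (x : Elt M) (φ : Elt M →ₗ[ℂ] ℂ), IsNormal φ → Continuous fun g => φ (α g x)
  contraction : ∀ g : G, ‖α g‖ ≤ 1
  positive : ∀ (g : G) (x : Elt M), 0 ≤ x → 0 ≤ α g x
  subunital : ∀ g : G, α g 1 ≤ 1

/-- `ρ` is a `G`-invariant normal state. -/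
def IsInvariantNormalState (α : G → (Elt M →L[ℂ] Elt M)) (ρ : Elt M →ₗ[ℂ] ℂ) : Prop :=
  IsNormalState ρ ∧ ∀ (g : G) (x : Elt M), ρ (α g x) = ρ x

/-- `y = (1 / m(K)) ∫_K α_g(x) dm(g)`, as a weak-* integral; `M_*` separates the points of `M`, so
there is at most one such `y`. -/
def IsAverage [MeasurableSpace G] (α : G → (Elt M →L[ℂ] Elt M)) (m : MeasureTheory.Measure G)
    (K : Set G) (x y : Elt M) : Prop :=
  ∀ φ : Elt M →ₗ[ℂ] ℂ, IsNormal φ →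
    φ y = ((m.real K)⁻¹ : ℝ) • ∫ g in K, φ (α g x) ∂m

/-- `x` is a weakly wandering operator: `x` is positive and the averages of `x` over the sets `K i`
tend to `0` in norm. -/
def IsWeaklyWandering [MeasurableSpace G] {ι : Type*} [Preorder ι]
    (α : G → (Elt M →L[ℂ] Elt M)) (m : MeasureTheory.Measure G) (K : ι → Set G) (x : Elt M) :
    Prop :=
  0 ≤ x ∧ ∃ A : ι → Elt M, (∀ i, IsAverage α m (K i) x (A i)) ∧
    Filter.Tendsto (fun i => ‖A i‖) Filter.atTop (nhds 0)

/-- `e₁ + e₂ = 1`, where `e₂` is the support of a weakly wandering operator and `e₁` is the support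
of a `G`-invariant normal state; when there is no such state at all, this means `e₁ = 0`. -/
structure IsNeveuDecomposition [MeasurableSpace G] {ι : Type*} [Preorder ι]
    (α : G → (Elt M →L[ℂ] Elt M)) (m : MeasureTheory.Measure G) (K : ι → Set G)
    (e₁ e₂ : Elt M) : Prop where
  isStarProjection_fst : IsStarProjection e₁
  isStarProjection_snd : IsStarProjection e₂
  add_eq_one : e₁ + e₂ = 1
  invariant : (∃ ρ, IsInvariantNormalState α ρ ∧ IsFunctionalSupport ρ e₁) ∨
    (e₁ = 0 ∧ ¬ ∃ ρ, IsInvariantNormalState α ρ)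
  wandering : ∃ x₀, IsWeaklyWandering α m K x₀ ∧ IsOperatorSupport x₀ e₂

end Dynamics

end Neveu

/-! ### Order structure of a von Neumann algebra. -/

namespace Neveu

variable {H : Type*} [NormedAddCommGroup H] [InnerProductSpace ℂ H] [CompleteSpace H]
variable {M : VonNeumannAlgebra H}

-- The main point is a local existence statement (`IsAveraging.exists_weaklyWandering_le`): if every
-- invariant normal positive functional vanishes on `y ≥ 0`, and some normal positive functional
-- does not, then a nonzero weakly wandering operator lies below `y`.
--
-- To see this, fix `φ` normal positive and look at the convex set `S` of those `0 ≤ x ≤ y` with `φ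
-- (y - x) ≤ δ`. Suppose all averages of all elements of `S` had norm at least `ε`. Hahn–Banach
-- (`exists_positive_separating`) gives uniformly bounded positive functionals `μ i` with `μ i (A i
-- x) ≥ ε` on `S`, and an ultrafilter limit of `μ i ∘ A i` is an invariant positive functional `ψ ≥
-- ε` on `S`. Split `ψ` into a normal and a singular part. The normal part is again invariant
-- (`exists_invariant_normal_add_singular`), hence zero on `y` and on `S`; the singular part is
-- smaller than `ε` at some point of `S`. This contradiction makes the averages small at some point
-- of `S`. Iterating with summable losses and taking the weak-* limit of the resulting decreasing
-- sequence gives an operator some of whose averages are arbitrarily small in norm. Since `A i (A j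
-- x) - A i x` tends to `0` in norm, all late averages are then small.
--
-- The normal-plus-singular splitting is carried out inside the GNS representation. The vectors
-- whose functionals are normal form a closed invariant subspace (`dominatedSubmodule`), and vectors
-- orthogonal to it are separated from normal functionals by effects `0 ≤ f ≤ 1`.
--
-- Globally, `σ`-finiteness provides a largest support `e₁` of invariant functionals and a largest
-- support `e₂` of weakly wandering operators. They are orthogonal, because an invariant functional
-- takes the same value on `x` and on its averages. The local statement applied to `1 - e₁ - e₂`
-- contradicts the maximality of `e₂` unless this projection is `0`. Uniqueness follows from
-- orthogonality alone.

scoped instance isClosed_coe_toStarSubalgebra : IsClosed (M.toStarSubalgebra : Set (H →L[ℂ] H)) := by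
  rw [VonNeumannAlgebra.coe_toStarSubalgebra, ← VonNeumannAlgebra.centralizer_centralizer]
  exact Set.isClosed_centralizer _

/-- Membership in a von Neumann algebra through commutation with its commutant. -/
theorem mem_of_forall_commutant {x : H →L[ℂ] H}
    (h : ∀ u : H →L[ℂ] H, u ∈ M.commutant → u * x = x * u) : x ∈ M.toStarSubalgebra := by
  have : x ∈ M.commutant.commutant := VonNeumannAlgebra.mem_commutant_iff.2 h
  rwa [VonNeumannAlgebra.commutant_commutant] at this

theorem commutant_comm {u : H →L[ℂ] H} (hu : u ∈ M.commutant) (x : Elt M) :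
    (x : H →L[ℂ] H) * u = u * (x : H →L[ℂ] H) :=
  VonNeumannAlgebra.mem_commutant_iff.1 hu x x.2

theorem commutant_comm_apply {u : H →L[ℂ] H} (hu : u ∈ M.commutant) (x : Elt M) (ξ : H) :
    (x : H →L[ℂ] H) (u ξ) = u ((x : H →L[ℂ] H) ξ) :=
  congrArg (fun T : H →L[ℂ] H => T ξ) (commutant_comm hu x)

theorem sqrt_mem (x : Elt M) : CFC.sqrt (x : H →L[ℂ] H) ∈ M.toStarSubalgebra := by
  refine mem_of_forall_commutant fun u hu => ?_
  have h : Commute (x : H →L[ℂ] H) u := commutant_comm hu x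
  rw [CFC.sqrt]
  exact (h.cfcₙ_nnreal NNReal.sqrt).eq.symm

scoped instance : StarOrderedRing (Elt M) :=
  StarOrderedRing.of_nonneg_iff' (fun {_ _} h z => add_le_add_right h z) fun x => by
    constructor
    · intro hx
      refine ⟨⟨_, sqrt_mem x⟩, Subtype.ext ?_⟩
      have h1 : IsSelfAdjoint (CFC.sqrt (x : H →L[ℂ] H)) := (CFC.sqrt_nonneg _).isSelfAdjoint
      change (x : H →L[ℂ] H) = star (CFC.sqrt (x : H →L[ℂ] H)) * CFC.sqrt (x : H →L[ℂ] H)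
      rw [h1.star_eq, CFC.sqrt_mul_sqrt_self (x : H →L[ℂ] H) hx]
    · rintro ⟨s, rfl⟩
      exact star_mul_self_nonneg (s : H →L[ℂ] H)

end Neveu

/-! ### The amplification to countably many copies. -/

namespace ContinuousLinearMap

variable {F : Type*} [NormedAddCommGroup F] [InnerProductSpace ℂ F] [CompleteSpace F]

/-- The diagonal action of the bounded operators on `F` on the Hilbert sum of countably many copies
of `F`. -/
noncomputable def amplification :
    (F →L[ℂ] F) →⋆ₐ[ℂ] (lp (fun _ : ℕ => F) 2 →L[ℂ] lp (fun _ : ℕ => F) 2) where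
  toFun T := lp.mapCLM 2 (fun _ => T) (norm_nonneg T) (fun _ => le_rfl)
  map_one' := by ext; simp
  map_mul' S T := by ext; simp
  map_zero' := by ext; simp
  map_add' S T := by ext; simp
  commutes' c := by ext; simp [Algebra.algebraMap_eq_smul_one]
  map_star' T := by
    refine (ContinuousLinearMap.eq_adjoint_iff _ _).2 fun v w => ?_
    simp only [lp.inner_eq_tsum, lp.mapCLM_apply_coe]
    simp [star_eq_adjoint, adjoint_inner_left]

@[simp]
theorem amplification_apply (T : F →L[ℂ] F) (v : lp (fun _ : ℕ => F) 2) (n : ℕ) :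
    amplification (F := F) T v n = T (v n) := by
  simp [amplification]

end ContinuousLinearMap

namespace Neveu

/-! ### Cyclic subspaces, intertwiners and ample representations. -/

section Representations

variable {A : Type*} [CStarAlgebra A]
variable {E F : Type*} [NormedAddCommGroup E] [InnerProductSpace ℂ E] [CompleteSpace E]
  [NormedAddCommGroup F] [InnerProductSpace ℂ F] [CompleteSpace F]
  (σ : A →⋆ₐ[ℂ] (E →L[ℂ] E)) (π : A →⋆ₐ[ℂ] (F →L[ℂ] F))

theorem rep_inner_left (x : A) (u v : F) : inner ℂ (π x u) v = inner ℂ u (π (star x) v) := by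
  rw [map_star, ContinuousLinearMap.star_eq_adjoint, ContinuousLinearMap.adjoint_inner_right]

theorem rep_mul_apply (x y : A) (v : F) : π (x * y) v = π x (π y v) := by
  rw [map_mul]; rfl

theorem rep_one_apply (v : F) : π 1 v = v := by
  rw [map_one]; rfl

theorem rep_norm_sq (x : A) (v : F) : (‖π x v‖ ^ 2 : ℂ) = inner ℂ v (π (star x * x) v) := by
  rw [rep_mul_apply, ← rep_inner_left]
  exact (inner_self_eq_norm_sq_to_K (𝕜 := ℂ) (π x v)).symm

/-- The orbit map `x ↦ π x v`. -/
noncomputable def orbitMap (v : F) : A →ₗ[ℂ] F where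
  toFun x := π x v
  map_add' x y := by simp
  map_smul' c x := by simp

@[simp] theorem orbitMap_apply (v : F) (x : A) : orbitMap π v x = π x v := rfl

/-- The closed cyclic subspace generated by `v`. -/
noncomputable def cyclicSubspace (v : F) : Submodule ℂ F :=
  (LinearMap.range (orbitMap π v)).topologicalClosure

instance (v : F) : CompleteSpace (cyclicSubspace π v) :=
  (Submodule.isClosed_topologicalClosure _).completeSpace_coe

theorem rep_mem_cyclicSubspace (v : F) (x : A) : π x v ∈ cyclicSubspace π v :=
  Submodule.le_topologicalClosure _ ⟨x, rfl⟩

/-- The orbit map, as a map to the cyclic subspace. -/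
noncomputable def cyclicMap (v : F) : A →ₗ[ℂ] cyclicSubspace π v :=
  (orbitMap π v).codRestrict _ (rep_mem_cyclicSubspace π v)

theorem denseRange_cyclicMap (v : F) : DenseRange (cyclicMap π v) := by
  intro w
  rw [closure_subtype]
  have h1 : (w : F) ∈ closure (Set.range (orbitMap π v)) := w.2
  convert h1
  ext u
  constructor
  · rintro ⟨_, ⟨x, rfl⟩, rfl⟩
    exact ⟨x, rfl⟩
  · rintro ⟨x, rfl⟩
    exact ⟨_, ⟨x, rfl⟩, rfl⟩

theorem self_mem_cyclicSubspace (v : F) : v ∈ cyclicSubspace π v := by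
  simpa using rep_mem_cyclicSubspace π v 1

theorem cyclicSubspace_invariant (v : F) (x : A) {w : F} (hw : w ∈ cyclicSubspace π v) :
    π x w ∈ cyclicSubspace π v := by
  have : Set.MapsTo (π x) (LinearMap.range (orbitMap π v) : Set F)
      (LinearMap.range (orbitMap π v) : Set F) := by
    rintro _ ⟨y, rfl⟩
    exact ⟨x * y, by simp⟩
  exact this.closure (π x).continuous hw

/-- The range of a `*`-representation is closed under adjoints, so an invariant subspace is
reducing. -/
theorem starProjection_rep {W : Submodule ℂ F} [W.HasOrthogonalProjection]
    (hW : ∀ x, ∀ w ∈ W, π x w ∈ W) (x : A) (v : F) :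
    W.starProjection (π x v) = π x (W.starProjection v) := by
  refine (Submodule.eq_starProjection_of_mem_of_inner_eq_zero
    (hW x _ (Submodule.starProjection_apply_mem W v)) fun w hw => ?_)
  rw [← map_sub, rep_inner_left]
  exact Submodule.starProjection_inner_eq_zero v _ (hW _ _ hw)

/-- The domination makes `σ x ζ ↦ π x κ` well defined and bounded on the orbit of `ζ`. It extends to
the cyclic subspace, and is precomposed with the projection onto it, which commutes with `σ`. -/
theorem exists_intertwiner {ζ : E} {κ : F} (h : ∀ x, ‖π x κ‖ ≤ ‖σ x ζ‖) :
    ∃ V : E →L[ℂ] F, V ζ = κ ∧ ∀ x v, V (σ x v) = π x (V v) := by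
  let W := cyclicSubspace σ ζ
  let e : A →ₗ[ℂ] W := cyclicMap σ ζ
  have hcoe : ∀ x, (e x : E) = σ x ζ := fun x => rfl
  have he : DenseRange e := denseRange_cyclicMap σ ζ
  let V₀ : W →L[ℂ] F := (orbitMap π κ).extendOfNorm e
  have hV : ∀ x, V₀ (e x) = π x κ := fun x =>
    LinearMap.extendOfNorm_eq he ⟨1, fun x => by simpa [hcoe] using h x⟩ x
  have hV' : ∀ (x : A) (w : W), V₀ ⟨σ x w, cyclicSubspace_invariant σ ζ x w.2⟩ = π x (V₀ w) := by
    intro x w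
    refine he.induction_on (p := fun w : W =>
      V₀ ⟨σ x w, cyclicSubspace_invariant σ ζ x w.2⟩ = π x (V₀ w)) w ?_ fun a => ?_
    · refine isClosed_eq (V₀.continuous.comp ?_) (by fun_prop)
      exact Continuous.subtype_mk (by fun_prop) _
    · rw [hV, ← rep_mul_apply, ← hV]
      congr 1
      ext
      simp [hcoe]
  refine ⟨V₀ ∘L W.orthogonalProjectionOnto, ?_, fun x v => ?_⟩
  · have : W.orthogonalProjectionOnto ζ = e 1 := by
      ext
      have := Submodule.starProjection_eq_self_iff.2 (self_mem_cyclicSubspace σ ζ)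
      simpa [hcoe] using this
    simp [this, hV]
  · have := starProjection_rep σ (W := W) (fun x w hw => cyclicSubspace_invariant σ ζ x hw) x v
    simp only [ContinuousLinearMap.comp_apply]
    rw [← hV']
    congr 1
    exact Subtype.ext this

/-- If the orbit of `κ` is dominated by the orbit of `ζ`, then the vector functional of `κ` is a
vector functional of the representation containing `ζ`. -/
theorem exists_norm_eq {ζ : E} {κ : F} (h : ∀ x, ‖π x κ‖ ≤ ‖σ x ζ‖) :
    ∃ ζ' : E, ∀ x, ‖π x κ‖ = ‖σ x ζ'‖ := by
  obtain ⟨V, hVζ, hV⟩ := exists_intertwiner σ π h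
  -- A Radon–Nikodym argument: `T = V* V` commutes with `σ`, hence so does `√T`, and `‖√T v‖ = ‖V
  -- v‖`. So `√T ζ` has the same orbit norms as `V ζ = κ`.
  let T : E →L[ℂ] E := V.adjoint ∘L V
  have hT0 : 0 ≤ T := by
    rw [ContinuousLinearMap.nonneg_iff_isPositive]
    exact ContinuousLinearMap.isPositive_adjoint_comp_self V
  have hVadj : ∀ x v, V.adjoint (π x v) = σ x (V.adjoint v) := by
    intro x v
    refine ext_inner_right ℂ fun w => ?_
    rw [ContinuousLinearMap.adjoint_inner_left, rep_inner_left, rep_inner_left, ← hV,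
      ContinuousLinearMap.adjoint_inner_left]
  have hcomm : ∀ x, Commute T (σ x) := by
    intro x
    ext v
    simp [T, hV, hVadj]
  have hsq : ∀ x v, CFC.sqrt T (σ x v) = σ x (CFC.sqrt T v) := by
    intro x v
    have := ((hcomm x).cfcₙ_nnreal NNReal.sqrt).eq
    exact congrArg (fun S : E →L[ℂ] E => S v) this
  refine ⟨CFC.sqrt T ζ, fun x => ?_⟩
  rw [← hVζ, ← hV, ← hsq]
  have h1 : ∀ v : E, inner ℂ (CFC.sqrt T v) (CFC.sqrt T v) = inner ℂ (V v) (V v) := by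
    intro v
    have hsa : IsSelfAdjoint (CFC.sqrt T) := (CFC.sqrt_nonneg T).isSelfAdjoint
    have h2 : CFC.sqrt T (CFC.sqrt T v) = T v :=
      congrArg (fun S : E →L[ℂ] E => S v) (CFC.sqrt_mul_sqrt_self T hT0)
    rw [← ContinuousLinearMap.adjoint_inner_right, ← ContinuousLinearMap.star_eq_adjoint,
      hsa.star_eq, h2]
    simp [T, ContinuousLinearMap.adjoint_inner_right]
  have h3 := h1 (σ x ζ)
  rw [inner_self_eq_norm_sq_to_K, inner_self_eq_norm_sq_to_K] at h3
  have h4 : ‖CFC.sqrt T (σ x ζ)‖ ^ 2 = ‖V (σ x ζ)‖ ^ 2 := by exact_mod_cast h3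
  exact ((sq_eq_sq₀ (norm_nonneg _) (norm_nonneg _)).1 h4).symm

/-- A representation is ample if square-summable families of vectors can be merged into one. -/
def IsAmple : Prop :=
  ∀ ζ : ℕ → E, Summable (fun j => ‖ζ j‖ ^ 2) →
    ∃ ζ' : E, ∀ x, HasSum (fun j => ‖σ x (ζ j)‖ ^ 2) (‖σ x ζ'‖ ^ 2)

variable {σ}

theorem IsAmple.merge (hσ : IsAmple σ) (ζ₁ ζ₂ : E) :
    ∃ ζ : E, ∀ x, ‖σ x ζ‖ ^ 2 = ‖σ x ζ₁‖ ^ 2 + ‖σ x ζ₂‖ ^ 2 := by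
  let ζ : ℕ → E := fun j => if j = 0 then ζ₁ else if j = 1 then ζ₂ else 0
  have hz : ∀ j ∉ Finset.range 2, ζ j = 0 := by
    intro j hj
    simp only [Finset.mem_range, not_lt] at hj
    simp [ζ, show j ≠ 0 by omega, show j ≠ 1 by omega]
  obtain ⟨ζ', h⟩ := hσ ζ (summable_of_ne_finset_zero (s := Finset.range 2)
    fun j hj => by simp [hz j hj])
  refine ⟨ζ', fun x => (h x).unique ?_⟩
  have := hasSum_sum_of_ne_finset_zero (L := .unconditional ℕ) (f := fun j => ‖σ x (ζ j)‖ ^ 2)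
    (s := Finset.range 2) fun j hj => by simp [hz j hj]
  simpa [Finset.sum_range_succ, ζ] using this

/-- A sequence of square-summable sequences is one square-summable family over `ℕ × ℕ`, which is
re-indexed by `ℕ`. -/
theorem isAmple_amplification (τ : A →⋆ₐ[ℂ] (F →L[ℂ] F)) :
    IsAmple ((ContinuousLinearMap.amplification (F := F)).comp τ) := by
  intro ζ hζ
  have hnorm : ∀ v : lp (fun _ : ℕ => F) 2, HasSum (fun n => ‖v n‖ ^ 2) (‖v‖ ^ 2) := by
    intro v
    simpa using lp.hasSum_norm (p := 2) (by norm_num) v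
  have hsum : Summable (fun p : ℕ × ℕ => ‖ζ p.1 p.2‖ ^ 2) := by
    rw [summable_prod_of_nonneg (fun _ => by positivity)]
    exact ⟨fun j => (hnorm (ζ j)).summable, by simpa [(hnorm _).tsum_eq] using hζ⟩
  let e : ℕ ≃ ℕ × ℕ := Nat.pairEquiv.symm
  have hmem : Memℓp (fun n => ζ (e n).1 (e n).2) 2 := by
    rw [memℓp_gen_iff (by norm_num)]
    simpa [Function.comp_def] using e.summable_iff.2 hsum
  refine ⟨⟨_, hmem⟩, fun x => ?_⟩
  have h1 := hnorm ((ContinuousLinearMap.amplification (F := F)).comp τ x ⟨_, hmem⟩)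
  have h2 : HasSum (fun p : ℕ × ℕ => ‖τ x (ζ p.1 p.2)‖ ^ 2)
      (‖(ContinuousLinearMap.amplification (F := F)).comp τ x ⟨_, hmem⟩‖ ^ 2) := by
    rw [← e.hasSum_iff]
    simpa [Function.comp_def] using h1
  have h3 := fun j => hnorm ((ContinuousLinearMap.amplification (F := F)).comp τ x (ζ j))
  refine h2.prod_fiberwise fun j => ?_
  simpa using h3 j

end Representations
-- The subspace of vectors with normal functional.
section Dominated

variable {A : Type*} [CStarAlgebra A]
variable {E F : Type*} [NormedAddCommGroup E] [InnerProductSpace ℂ E] [CompleteSpace E]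
  [NormedAddCommGroup F] [InnerProductSpace ℂ F] [CompleteSpace F]
  {σ : A →⋆ₐ[ℂ] (E →L[ℂ] E)} (hσ : IsAmple σ) (π : A →⋆ₐ[ℂ] (F →L[ℂ] F))

theorem norm_rep_smul (c : ℝ) (hc : 0 ≤ c) (x : A) (v : F) :
    ‖π x ((c : ℂ) • v)‖ = c * ‖π x v‖ := by
  rw [map_smul, norm_smul, Complex.norm_real, Real.norm_of_nonneg hc]

theorem exists_dominating_of_le {κ : F} {ζ : E} {c : ℝ} (hc : 0 ≤ c)
    (h : ∀ x, ‖π x κ‖ ≤ c * ‖σ x ζ‖) : ∃ ζ' : E, ∀ x, ‖π x κ‖ ≤ ‖σ x ζ'‖ :=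
  ⟨(c : ℂ) • ζ, fun x => by rw [norm_rep_smul σ c hc]; exact h x⟩

/-- The vectors of a representation `π` whose orbit is dominated by the orbit of a vector of the
ample representation `σ`. -/
def dominatedSubmodule : Submodule ℂ F where
  carrier := {κ | ∃ ζ : E, ∀ x, ‖π x κ‖ ≤ ‖σ x ζ‖}
  zero_mem' := ⟨0, fun x => by simp⟩
  add_mem' := by
    rintro κ₁ κ₂ ⟨ζ₁, h₁⟩ ⟨ζ₂, h₂⟩
    obtain ⟨ζ, hζ⟩ := hσ.merge ζ₁ ζ₂
    refine exists_dominating_of_le π (ζ := ζ) (c := 2) (by norm_num) fun x => ?_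
    have h₃ : ‖σ x ζ₁‖ ≤ ‖σ x ζ‖ :=
      (sq_le_sq₀ (norm_nonneg _) (norm_nonneg _)).1 (by rw [hζ]; nlinarith [sq_nonneg ‖σ x ζ₂‖])
    have h₄ : ‖σ x ζ₂‖ ≤ ‖σ x ζ‖ :=
      (sq_le_sq₀ (norm_nonneg _) (norm_nonneg _)).1 (by rw [hζ]; nlinarith [sq_nonneg ‖σ x ζ₁‖])
    rw [map_add]
    linarith [norm_add_le (π x κ₁) (π x κ₂), h₁ x, h₂ x]
  smul_mem' := by
    rintro c κ ⟨ζ, h⟩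
    refine exists_dominating_of_le π (ζ := ζ) (norm_nonneg c) fun x => ?_
    rw [map_smul, norm_smul]
    exact mul_le_mul_of_nonneg_left (h x) (norm_nonneg c)

theorem rep_mem_dominatedSubmodule (a : A) {κ : F} (hκ : κ ∈ dominatedSubmodule hσ π) :
    π a κ ∈ dominatedSubmodule hσ π := by
  obtain ⟨ζ, h⟩ := hκ
  refine ⟨σ a ζ, fun x => ?_⟩
  rw [← rep_mul_apply, ← rep_mul_apply]
  exact h _

/-- Approximate `κ` geometrically by dominated `v j`. Each increment `v (j + 1) - v j` has the orbit
norms of some `ζ j`, and the choice `x = 1` bounds `‖ζ j‖`. The vectors `2 ^ j • ζ j` are still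
square summable and merge into one `Z`; Cauchy–Schwarz with weights `2⁻ʲ` then bounds all partial
sums by the orbit of `Z`. -/
theorem isClosed_dominatedSubmodule : IsClosed (dominatedSubmodule hσ π : Set F) := by
  refine isClosed_of_closure_subset fun κ hκ => ?_
  have hex : ∀ j : ℕ, ∃ v ∈ dominatedSubmodule hσ π, dist κ v < (1 / 4) ^ j := fun j =>
    Metric.mem_closure_iff.1 hκ _ (by positivity)
  choose v hv hd using hex
  have hd' : ∀ j, ‖v (j + 1) - v j‖ ≤ 2 * (1 / 4) ^ j := by
    intro j
    have h1 := dist_triangle_left (v (j + 1)) (v j) κ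
    have h2 : (1 / 4 : ℝ) ^ (j + 1) ≤ (1 / 4) ^ j :=
      pow_le_pow_of_le_one (by norm_num) (by norm_num) (Nat.le_succ j)
    rw [← dist_eq_norm]
    linarith [hd j, hd (j + 1)]
  have hex2 : ∀ j, ∃ ζ : E, ∀ x, ‖π x (v (j + 1) - v j)‖ = ‖σ x ζ‖ := fun j => by
    obtain ⟨ζ, h⟩ := (dominatedSubmodule hσ π).sub_mem (hv (j + 1)) (hv j)
    exact exists_norm_eq σ π h
  choose ζ hζ using hex2
  have hζn : ∀ j, ‖ζ j‖ ≤ 2 * (1 / 4) ^ j := fun j => by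
    have := hζ j 1
    rw [rep_one_apply, rep_one_apply] at this
    rw [← this]; exact hd' j
  have hsum : Summable (fun j => ‖((2 ^ j : ℝ) : ℂ) • ζ j‖ ^ 2) := by
    refine Summable.of_nonneg_of_le (fun j => by positivity) (fun j => ?_)
      ((summable_geometric_of_lt_one (r := (1 / 4 : ℝ)) (by norm_num) (by norm_num)).mul_left 4)
    rw [norm_smul, Complex.norm_real, Real.norm_of_nonneg (by positivity)]
    calc (2 ^ j * ‖ζ j‖) ^ 2 ≤ (2 ^ j * (2 * (1 / 4) ^ j)) ^ 2 := by gcongr; exact hζn j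
      _ = 4 * (1 / 4) ^ j := by
        have : (1 / 4 : ℝ) ^ j = (1 / 2) ^ j * (1 / 2) ^ j := by rw [← mul_pow]; norm_num
        have h2 : (2 : ℝ) ^ j * (1 / 2) ^ j = 1 := by rw [← mul_pow]; norm_num
        rw [this]
        calc _ = 4 * ((2 : ℝ) ^ j * (1 / 2) ^ j) ^ 2 * ((1 / 2) ^ j * (1 / 2) ^ j) := by ring
          _ = _ := by rw [h2]; ring
  obtain ⟨Z, hZ⟩ := hσ _ hsum
  have hfin : ∀ x n, ‖π x (v n - v 0)‖ ≤ 2 * ‖σ x Z‖ := by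
    intro x n
    have h1 : ‖π x (v n - v 0)‖ ≤ ∑ j ∈ Finset.range n, (1 / 2 : ℝ) ^ j * (2 ^ j * ‖σ x (ζ j)‖) := by
      rw [← Finset.sum_range_sub, map_sum]
      refine (norm_sum_le _ _).trans_eq (Finset.sum_congr rfl fun j _ => ?_)
      rw [hζ, ← mul_assoc, ← mul_pow]
      norm_num
    have h2 : (∑ j ∈ Finset.range n, (1 / 2 : ℝ) ^ j * (2 ^ j * ‖σ x (ζ j)‖)) ^ 2 ≤
        (∑ j ∈ Finset.range n, ((1 / 2 : ℝ) ^ j) ^ 2) *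
          ∑ j ∈ Finset.range n, (2 ^ j * ‖σ x (ζ j)‖) ^ 2 :=
      Finset.sum_mul_sq_le_sq_mul_sq _ _ _
    have h3 : ∑ j ∈ Finset.range n, (2 ^ j * ‖σ x (ζ j)‖) ^ 2 ≤ ‖σ x Z‖ ^ 2 := by
      have := sum_le_hasSum (Finset.range n) (fun j _ => by positivity) (hZ x)
      refine le_trans (Finset.sum_le_sum fun j _ => ?_) this
      rw [norm_rep_smul σ _ (by positivity)]
    have h4 : ∑ j ∈ Finset.range n, ((1 / 2 : ℝ) ^ j) ^ 2 ≤ 4 := by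
      have h5 : HasSum (fun j : ℕ => (1 / 4 : ℝ) ^ j) (1 - 1 / 4)⁻¹ :=
        hasSum_geometric_of_lt_one (by norm_num) (by norm_num)
      have := sum_le_hasSum (Finset.range n) (fun j _ => by positivity) h5
      have h6 : ∑ j ∈ Finset.range n, ((1 / 2 : ℝ) ^ j) ^ 2 =
          ∑ j ∈ Finset.range n, (1 / 4 : ℝ) ^ j :=
        Finset.sum_congr rfl fun j _ => by rw [← pow_mul, mul_comm, pow_mul]; norm_num
      rw [h6]
      exact this.trans (by norm_num)
    refine h1.trans (abs_le_of_sq_le_sq' ?_ (by positivity)).2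
    calc _ ≤ _ := h2
      _ ≤ 4 * ‖σ x Z‖ ^ 2 := by gcongr
      _ = _ := by ring
  have hlim : Filter.Tendsto v Filter.atTop (nhds κ) := by
    rw [tendsto_iff_dist_tendsto_zero]
    refine squeeze_zero (fun _ => dist_nonneg) (fun j => ?_)
      (tendsto_pow_atTop_nhds_zero_of_lt_one (r := (1 / 4 : ℝ)) (by norm_num) (by norm_num))
    rw [dist_comm]; exact (hd j).le
  have hmem : κ - v 0 ∈ dominatedSubmodule hσ π := by
    refine exists_dominating_of_le π (ζ := Z) (c := 2) (by norm_num) fun x => ?_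
    have : Filter.Tendsto (fun n => ‖π x (v n - v 0)‖) Filter.atTop (nhds ‖π x (κ - v 0)‖) :=
      (((π x).continuous.tendsto _).comp (hlim.sub_const _)).norm
    exact le_of_tendsto' this (hfin x)
  simpa using (dominatedSubmodule hσ π).add_mem hmem (hv 0)

instance : CompleteSpace (dominatedSubmodule hσ π) :=
  (isClosed_dominatedSubmodule hσ π).completeSpace_coe

theorem rep_mem_dominatedSubmodule_orthogonal (a : A) {η : F}
    (hη : η ∈ (dominatedSubmodule hσ π)ᗮ) : π a η ∈ (dominatedSubmodule hσ π)ᗮ := by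
  rw [Submodule.mem_orthogonal'] at hη ⊢
  intro u hu
  rw [rep_inner_left]
  exact hη _ (rep_mem_dominatedSubmodule hσ π _ hu)

end Dominated

/-! ### Separating dominated vectors from their orthogonal complement. -/

section ApproximateUnits

variable {A : Type*} [CStarAlgebra A]
variable {E F : Type*} [NormedAddCommGroup E] [InnerProductSpace ℂ E] [CompleteSpace E]
  [NormedAddCommGroup F] [InnerProductSpace ℂ F] [CompleteSpace F]

/-- The direct sum of two representations. -/
noncomputable def prodRep (σ : A →⋆ₐ[ℂ] (E →L[ℂ] E)) (π : A →⋆ₐ[ℂ] (F →L[ℂ] F)) :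
    A →⋆ₐ[ℂ] (WithLp 2 (E × F) →L[ℂ] WithLp 2 (E × F)) where
  toFun x := (WithLp.prodContinuousLinearEquiv 2 ℂ E F).symm.toContinuousLinearMap ∘L
    ((σ x).prodMap (π x)) ∘L (WithLp.prodContinuousLinearEquiv 2 ℂ E F).toContinuousLinearMap
  map_one' := by
    refine ContinuousLinearMap.ext fun v => WithLp.ofLp_injective 2 (Prod.ext ?_ ?_) <;>
      simp
  map_mul' x y := by
    refine ContinuousLinearMap.ext fun v => WithLp.ofLp_injective 2 (Prod.ext ?_ ?_) <;>
      simp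
  map_zero' := by
    refine ContinuousLinearMap.ext fun v => WithLp.ofLp_injective 2 (Prod.ext ?_ ?_) <;>
      simp
  map_add' x y := by
    refine ContinuousLinearMap.ext fun v => WithLp.ofLp_injective 2 (Prod.ext ?_ ?_) <;>
      simp
  commutes' c := by
    refine ContinuousLinearMap.ext fun v => WithLp.ofLp_injective 2 (Prod.ext ?_ ?_) <;>
      simp [Algebra.algebraMap_eq_smul_one]
  map_star' x := by
    refine (ContinuousLinearMap.eq_adjoint_iff _ _).2 fun v w => ?_
    simp only [WithLp.prod_inner_apply]
    exact congrArg₂ (· + ·) (by simpa using rep_inner_left σ (star x) v.fst w.fst)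
      (by simpa using rep_inner_left π (star x) v.snd w.snd)

@[simp] theorem prodRep_apply_fst (σ : A →⋆ₐ[ℂ] (E →L[ℂ] E)) (π : A →⋆ₐ[ℂ] (F →L[ℂ] F)) (x : A)
    (v : WithLp 2 (E × F)) : (prodRep σ π x v).fst = σ x v.fst := rfl

@[simp] theorem prodRep_apply_snd (σ : A →⋆ₐ[ℂ] (E →L[ℂ] E)) (π : A →⋆ₐ[ℂ] (F →L[ℂ] F)) (x : A)
    (v : WithLp 2 (E × F)) : (prodRep σ π x v).snd = π x v.snd := rfl

variable {σ : A →⋆ₐ[ℂ] (E →L[ℂ] E)} (hσ : IsAmple σ) (π : A →⋆ₐ[ℂ] (F →L[ℂ] F))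

/-- The claim is that `p = (ζ, 0)` lies in the closed orbit `R` of `w = (ζ, η)`. The second
component of the projection of `p` onto `R` is dominated by `ζ`, hence orthogonal to `η`. Therefore
`p` minus its projection, which is orthogonal to `w`, is orthogonal to `p` as well, so it is `0`. -/
theorem exists_rep_near_one_near_zero (ζ : E) {η : F} (hη : η ∈ (dominatedSubmodule hσ π)ᗮ)
    {ε : ℝ} (hε : 0 < ε) : ∃ x : A, ‖σ x ζ - ζ‖ < ε ∧ ‖π x η‖ < ε := by
  let w : WithLp 2 (E × F) := WithLp.toLp 2 (ζ, η)
  let p : WithLp 2 (E × F) := WithLp.toLp 2 (ζ, 0)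
  let R := cyclicSubspace (prodRep σ π) w
  have hfst : ∀ v : WithLp 2 (E × F), ‖v.fst‖ ^ 2 + ‖v.snd‖ ^ 2 = ‖v‖ ^ 2 := fun v =>
    (WithLp.prod_norm_sq_eq_of_L2 v).symm
  have hb : (R.starProjection p).snd ∈ dominatedSubmodule hσ π := by
    refine ⟨ζ, fun x => ?_⟩
    have h1 := starProjection_rep (prodRep σ π) (W := R)
      (fun x w hw => cyclicSubspace_invariant _ _ x hw) x p
    have h2 : ‖prodRep σ π x p‖ = ‖σ x ζ‖ := by
      have := hfst (prodRep σ π x p)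
      rw [prodRep_apply_fst, prodRep_apply_snd] at this
      change ‖σ x ζ‖ ^ 2 + ‖π x 0‖ ^ 2 = _ at this
      rw [map_zero, norm_zero] at this
      refine ((sq_eq_sq₀ (norm_nonneg _) (norm_nonneg _)).1 ?_).symm
      linarith
    rw [← prodRep_apply_snd σ π, ← h1, ← h2]
    refine le_trans ?_ (R.norm_starProjection_apply_le _)
    refine (sq_le_sq₀ (norm_nonneg _) (norm_nonneg _)).1 ?_
    rw [← hfst (R.starProjection _)]
    nlinarith [sq_nonneg ‖(R.starProjection (prodRep σ π x p)).fst‖]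
  have h0 := Submodule.starProjection_inner_eq_zero (K := R) p w (self_mem_cyclicSubspace _ w)
  have h1 := Submodule.starProjection_inner_eq_zero (K := R) p _
    (Submodule.starProjection_apply_mem R p)
  have h2 : inner ℂ (p - R.starProjection p) p = 0 := by
    rw [WithLp.prod_inner_apply] at h0 ⊢
    have h3 : inner ℂ (p - R.starProjection p).snd η = 0 := by
      have : (p - R.starProjection p).snd = -(R.starProjection p).snd := by simp [p]
      rw [this, inner_neg_left, (Submodule.mem_orthogonal _ _).1 hη _ hb, neg_zero]
    have h4 : inner ℂ (p - R.starProjection p).fst ζ +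
      inner ℂ (p - R.starProjection p).snd η = 0 := h0
    change inner ℂ (p - R.starProjection p).fst ζ + inner ℂ (p - R.starProjection p).snd 0 = 0
    rw [inner_zero_right]
    rwa [h3] at h4
  have h3 : p - R.starProjection p = 0 := by
    rw [← inner_self_eq_zero (𝕜 := ℂ), inner_sub_right, h2, h1, sub_zero]
  have hp : p ∈ R := by
    rw [← Submodule.starProjection_eq_self_iff]
    exact (sub_eq_zero.1 h3).symm
  obtain ⟨_, ⟨x, rfl⟩, hx⟩ := Metric.mem_closure_iff.1 hp ε hε
  rw [dist_comm, dist_eq_norm] at hx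
  have h4 := hfst (orbitMap (prodRep σ π) w x - p)
  have h5 : (orbitMap (prodRep σ π) w x - p).fst = σ x ζ - ζ := rfl
  have h6 : (orbitMap (prodRep σ π) w x - p).snd = π x η := by
    change π x η - 0 = _
    rw [sub_zero]
  rw [h5, h6] at h4
  refine ⟨x, lt_of_le_of_lt ?_ hx, lt_of_le_of_lt ?_ hx⟩
  · refine (sq_le_sq₀ (norm_nonneg _) (norm_nonneg _)).1 ?_
    nlinarith [sq_nonneg ‖π x η‖]
  · refine (sq_le_sq₀ (norm_nonneg _) (norm_nonneg _)).1 ?_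
    nlinarith [sq_nonneg ‖σ x ζ - ζ‖]

end ApproximateUnits
-- From approximating elements to effects `0 ≤ f ≤ 1`.
section Effects

variable {A : Type*} [CStarAlgebra A]
variable {E F : Type*} [NormedAddCommGroup E] [InnerProductSpace ℂ E] [CompleteSpace E]
  [NormedAddCommGroup F] [InnerProductSpace ℂ F] [CompleteSpace F]
  {σ : A →⋆ₐ[ℂ] (E →L[ℂ] E)} (hσ : IsAmple σ) (π : A →⋆ₐ[ℂ] (F →L[ℂ] F))

/-- Take `x` acting almost as the identity on both `ζ` and `u` and almost as zero on both `η` and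
`v`. Merging `ζ, u` into `Z` and pairing `η, v` in `prodRep π π` reduces these four conditions to
the two of `exists_rep_near_one_near_zero`. -/
theorem inner_add_inner_eq_zero_of_forall_rep {ζ u : E} {η v : F}
    (hη : η ∈ (dominatedSubmodule hσ π)ᗮ) (hv : v ∈ (dominatedSubmodule hσ π)ᗮ)
    (h : ∀ x : A, inner ℂ u (σ x ζ) + inner ℂ ζ (σ x u) +
      (inner ℂ v (π x η) + inner ℂ η (π x v)) = 0) :
    inner ℂ u ζ + inner ℂ ζ u = 0 := by
  obtain ⟨Z, hZ⟩ := hσ.merge ζ u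
  have hw : (WithLp.toLp 2 (η, v) : WithLp 2 (F × F)) ∈
      (dominatedSubmodule hσ (prodRep π π))ᗮ := by
    rw [Submodule.mem_orthogonal]
    rintro κ ⟨ξ, hξ⟩
    have hn : ∀ w : WithLp 2 (F × F), ‖w.fst‖ ≤ ‖w‖ ∧ ‖w.snd‖ ≤ ‖w‖ := fun w => by
      have := WithLp.prod_norm_sq_eq_of_L2 w
      constructor <;> refine (sq_le_sq₀ (norm_nonneg _) (norm_nonneg _)).1 ?_ <;>
        nlinarith [sq_nonneg ‖w.fst‖, sq_nonneg ‖w.snd‖]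
    have h1 : κ.fst ∈ dominatedSubmodule hσ π := ⟨ξ, fun x => (hn _).1.trans (hξ x)⟩
    have h2 : κ.snd ∈ dominatedSubmodule hσ π := ⟨ξ, fun x => (hn _).2.trans (hξ x)⟩
    rw [WithLp.prod_inner_apply]
    change inner ℂ κ.fst η + inner ℂ κ.snd v = 0
    rw [(Submodule.mem_orthogonal _ _).1 hη _ h1, (Submodule.mem_orthogonal _ _).1 hv _ h2,
      add_zero]
  have key : ∀ ε : ℝ, 0 < ε → ‖inner ℂ u ζ + inner ℂ ζ u‖ ≤ ε * (‖u‖ + ‖ζ‖ + (‖v‖ + ‖η‖)) := by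
    intro ε hε
    obtain ⟨x, hx, hx'⟩ := exists_rep_near_one_near_zero hσ (prodRep π π) Z hw hε
    have hsub : ∀ w : E, σ (x - 1) w = σ x w - w := fun w => by simp
    rw [← hsub] at hx
    have h0 := hZ (x - 1)
    have h1 : ‖σ x ζ - ζ‖ ≤ ε := by
      rw [← hsub]
      refine le_trans ?_ hx.le
      refine (sq_le_sq₀ (norm_nonneg _) (norm_nonneg _)).1 ?_
      nlinarith [sq_nonneg ‖σ (x - 1) u‖]
    have h2 : ‖σ x u - u‖ ≤ ε := by
      rw [← hsub]
      refine le_trans ?_ hx.le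
      refine (sq_le_sq₀ (norm_nonneg _) (norm_nonneg _)).1 ?_
      nlinarith [sq_nonneg ‖σ (x - 1) ζ‖]
    have h00 := WithLp.prod_norm_sq_eq_of_L2 (prodRep π π x (WithLp.toLp 2 (η, v)))
    change _ = ‖π x η‖ ^ 2 + ‖π x v‖ ^ 2 at h00
    have h3 : ‖π x η‖ ≤ ε := by
      refine le_trans ?_ hx'.le
      refine (sq_le_sq₀ (norm_nonneg _) (norm_nonneg _)).1 ?_
      nlinarith [sq_nonneg ‖π x v‖]
    have h4 : ‖π x v‖ ≤ ε := by
      refine le_trans ?_ hx'.le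
      refine (sq_le_sq₀ (norm_nonneg _) (norm_nonneg _)).1 ?_
      nlinarith [sq_nonneg ‖π x η‖]
    have e : inner ℂ u ζ + inner ℂ ζ u = -(inner ℂ u (σ x ζ - ζ) + inner ℂ ζ (σ x u - u)) -
        (inner ℂ v (π x η) + inner ℂ η (π x v)) := by
      rw [inner_sub_right, inner_sub_right]
      linear_combination h x
    have i1 := (norm_inner_le_norm (𝕜 := ℂ) u (σ x ζ - ζ)).trans
      (mul_le_mul_of_nonneg_left h1 (norm_nonneg u))
    have i2 := (norm_inner_le_norm (𝕜 := ℂ) ζ (σ x u - u)).trans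
      (mul_le_mul_of_nonneg_left h2 (norm_nonneg ζ))
    have i3 := (norm_inner_le_norm (𝕜 := ℂ) v (π x η)).trans
      (mul_le_mul_of_nonneg_left h3 (norm_nonneg v))
    have i4 := (norm_inner_le_norm (𝕜 := ℂ) η (π x v)).trans
      (mul_le_mul_of_nonneg_left h4 (norm_nonneg η))
    rw [e]
    have j1 := norm_sub_le (-(inner ℂ u (σ x ζ - ζ) + inner ℂ ζ (σ x u - u)))
      (inner ℂ v (π x η) + inner ℂ η (π x v))
    rw [norm_neg] at j1
    have j2 := norm_add_le (inner ℂ u (σ x ζ - ζ)) (inner ℂ ζ (σ x u - u))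
    have j3 := norm_add_le (inner ℂ v (π x η)) (inner ℂ η (π x v))
    linarith
  rw [← norm_le_zero_iff]
  have hlim : Filter.Tendsto (fun ε : ℝ => ε * (‖u‖ + ‖ζ‖ + (‖v‖ + ‖η‖)))
      (nhdsWithin 0 (Set.Ioi 0)) (nhds 0) := by
    have : Filter.Tendsto (fun ε : ℝ => ε * (‖u‖ + ‖ζ‖ + (‖v‖ + ‖η‖))) (nhds 0)
      (nhds (0 * (‖u‖ + ‖ζ‖ + (‖v‖ + ‖η‖)))) := (continuous_id.mul continuous_const).tendsto 0
    rw [zero_mul] at this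
    exact this.mono_left nhdsWithin_le_nhds
  exact ge_of_tendsto hlim (by filter_upwards [self_mem_nhdsWithin] with ε hε using key ε hε)

/-- Self-adjointness is what makes functional calculus available afterwards. The self-adjoint orbit
of `(ζ, η)` is only a real subspace, so a real Hahn–Banach separation is used; the separating
functional is excluded by `inner_add_inner_eq_zero_of_forall_rep`. -/
theorem exists_selfAdjoint_near_one_near_zero (ζ : E) {η : F}
    (hη : η ∈ (dominatedSubmodule hσ π)ᗮ) {ε : ℝ} (hε : 0 < ε) :
    ∃ y : A, IsSelfAdjoint y ∧ ‖σ y ζ - ζ‖ < ε ∧ ‖π y η‖ < ε := by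
  let q : WithLp 2 (E × F) := WithLp.toLp 2 (ζ, η)
  let p : WithLp 2 (E × F) := WithLp.toLp 2 (ζ, 0)
  let S : Submodule ℝ (WithLp 2 (E × F)) :=
    ((selfAdjoint.submodule ℝ A).map ((orbitMap (prodRep σ π) q).restrictScalars ℝ))
  have hp : p ∈ closure (S : Set (WithLp 2 (E × F))) := by
    by_contra hp
    obtain ⟨f, r, hfr, hr⟩ := RCLike.geometric_hahn_banach_point_closed (𝕜 := ℂ)
      (S.convex.closure) isClosed_closure hp
    have hS : ∀ s ∈ S, RCLike.re (f s) = 0 := by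
      intro s hs
      by_contra hne
      have h1 := hr _ (subset_closure (S.smul_mem ((r - 1) / RCLike.re (f s)) hs))
      have h2 : RCLike.re (f (((r - 1) / RCLike.re (f s)) • s)) =
          ((r - 1) / RCLike.re (f s)) * RCLike.re (f s) := by
        rw [← Complex.coe_smul, map_smul, Complex.coe_smul, RCLike.smul_re]
      rw [h2, div_mul_cancel₀ _ hne] at h1
      linarith
    have h0 := hr 0 (subset_closure S.zero_mem)
    have hfp : RCLike.re (f p) < 0 := by
      have : RCLike.re (f 0) = 0 := by simp
      linarith
    let w := (InnerProductSpace.toDual ℂ (WithLp 2 (E × F))).symm f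
    have hw : ∀ s, f s = inner ℂ w s := fun s =>
      (InnerProductSpace.toDual_symm_apply (𝕜 := ℂ) (x := s) (y := f)).symm
    -- Only pairings with `π y η` matter, and these lie in the orthogonal complement, so `w.snd` may
    -- be projected there.
    let v' := (dominatedSubmodule hσ π)ᗮ.starProjection w.snd
    have hv' : v' ∈ (dominatedSubmodule hσ π)ᗮ := Submodule.starProjection_apply_mem _ _
    have hvv : ∀ t ∈ (dominatedSubmodule hσ π)ᗮ, inner ℂ w.snd t = inner ℂ v' t := by
      intro t ht
      have := Submodule.starProjection_inner_eq_zero w.snd t ht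
      rwa [inner_sub_left, sub_eq_zero] at this
    have hvv2 : ∀ t ∈ (dominatedSubmodule hσ π)ᗮ, inner ℂ t w.snd = inner ℂ t v' := by
      intro t ht
      rw [← inner_conj_symm, hvv t ht, inner_conj_symm]
    have hsa : ∀ y : A, IsSelfAdjoint y → inner ℂ w.fst (σ y ζ) + inner ℂ ζ (σ y w.fst) +
      (inner ℂ v' (π y η) + inner ℂ η (π y v')) = 0 := by
      intro y hy
      have h1 := hS (orbitMap (prodRep σ π) q y) ⟨y, hy, rfl⟩
      rw [hw, WithLp.prod_inner_apply] at h1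
      change RCLike.re (inner ℂ w.fst (σ y ζ) + inner ℂ w.snd (π y η)) = 0 at h1
      rw [hvv _ (rep_mem_dominatedSubmodule_orthogonal hσ π y hη)] at h1
      have h2 : inner ℂ ζ (σ y w.fst) = (starRingEnd ℂ) (inner ℂ w.fst (σ y ζ)) := by
        rw [inner_conj_symm, rep_inner_left, hy.star_eq]
      have h3 : inner ℂ η (π y v') = (starRingEnd ℂ) (inner ℂ v' (π y η)) := by
        rw [inner_conj_symm, rep_inner_left, hy.star_eq]
      rw [h2, h3]
      have h4 := RCLike.add_conj (K := ℂ) (inner ℂ w.fst (σ y ζ) + inner ℂ v' (π y η))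
      rw [h1, map_add] at h4
      simp only [RCLike.ofReal_zero, mul_zero] at h4
      linear_combination h4
    -- Adding the complex conjugate made the identity complex linear in `y`, so it passes from
    -- self-adjoint elements to all of `A`.
    have hall : ∀ x : A, inner ℂ w.fst (σ x ζ) + inner ℂ ζ (σ x w.fst) +
      (inner ℂ v' (π x η) + inner ℂ η (π x v')) = 0 := by
      intro x
      have h1 := hsa (realPart x : A) (realPart x).2
      have h2 := hsa (imaginaryPart x : A) (imaginaryPart x).2
      rw [← realPart_add_I_smul_imaginaryPart x]
      simp only [map_add, map_smul, add_apply, smul_apply,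
        inner_add_right, inner_smul_right]
      linear_combination h1 + Complex.I * h2
    have := inner_add_inner_eq_zero_of_forall_rep hσ π hη hv' hall
    have h5 : inner ℂ ζ w.fst = (starRingEnd ℂ) (inner ℂ w.fst ζ) := (inner_conj_symm _ _).symm
    rw [h5, RCLike.add_conj] at this
    have h6 : RCLike.re (f p) = RCLike.re (inner ℂ w.fst ζ) := by
      rw [hw, WithLp.prod_inner_apply]
      change RCLike.re (inner ℂ w.fst ζ + inner ℂ w.snd 0) = _
      rw [inner_zero_right, add_zero]
    rw [h6] at hfp
    have h7 : (2 : ℝ) * RCLike.re (inner ℂ w.fst ζ) = 0 := by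
      have h8 := congrArg Complex.re this
      simpa using h8
    linarith
  obtain ⟨_, ⟨y, hy, rfl⟩, hyp⟩ := Metric.mem_closure_iff.1 hp ε hε
  rw [dist_comm, dist_eq_norm] at hyp
  have h4 := WithLp.prod_norm_sq_eq_of_L2 (orbitMap (prodRep σ π) q y - p)
  have h5 : (orbitMap (prodRep σ π) q y - p).fst = σ y ζ - ζ := rfl
  have h6 : (orbitMap (prodRep σ π) q y - p).snd = π y η := by
    change π y η - 0 = _
    rw [sub_zero]
  rw [h5, h6] at h4
  refine ⟨y, hy, lt_of_le_of_lt ?_ hyp, lt_of_le_of_lt ?_ hyp⟩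
  · refine (sq_le_sq₀ (norm_nonneg _) (norm_nonneg _)).1 ?_
    change _ ≤ ‖orbitMap (prodRep σ π) q y - p‖ ^ 2
    nlinarith [sq_nonneg ‖π y η‖]
  · refine (sq_le_sq₀ (norm_nonneg _) (norm_nonneg _)).1 ?_
    change _ ≤ ‖orbitMap (prodRep σ π) q y - p‖ ^ 2
    nlinarith [sq_nonneg ‖σ y ζ - ζ‖]

variable [PartialOrder A] [StarOrderedRing A]

theorem inner_rep_nonneg {a : A} (ha : 0 ≤ a) (v : F) : 0 ≤ inner ℂ v (π a v) := by
  obtain ⟨s, rfl⟩ := CStarAlgebra.nonneg_iff_eq_star_mul_self.1 ha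
  rw [← rep_norm_sq]
  exact_mod_cast sq_nonneg ‖π s v‖

theorem inner_rep_mono {a b : A} (hab : a ≤ b) (v : F) :
    inner ℂ v (π a v) ≤ inner ℂ v (π b v) := by
  have := inner_rep_nonneg π (sub_nonneg.2 hab) v
  rwa [map_sub, sub_apply, inner_sub_right, sub_nonneg] at this

theorem exists_effect_le {y : A} (hy : IsSelfAdjoint y) :
    ∃ f : A, 0 ≤ f ∧ f ≤ 1 ∧ f ≤ (2 : ℂ) • (star y * y) ∧
      1 - f ≤ (2 : ℂ) • (star (1 - y) * (1 - y)) := by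
  -- This function vanishes to second order at `0` and equals `1` to second order at `1`. The
  -- denominator is at least `1 / 2`, whence the factor `2` in both bounds.
  let h : ℝ → ℝ := fun t => t ^ 2 / (t ^ 2 + (1 - t) ^ 2)
  have hpos : ∀ t : ℝ, 1 / 2 ≤ t ^ 2 + (1 - t) ^ 2 := fun t => by nlinarith [sq_nonneg (2 * t - 1)]
  have hc : Continuous h := by
    refine Continuous.div (by fun_prop) (by fun_prop) fun t => ?_
    linarith [hpos t]
  have h1 : ∀ t, h t ≤ 2 * t ^ 2 := fun t => by
    rw [div_le_iff₀ (by linarith [hpos t])]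
    nlinarith [hpos t, sq_nonneg t]
  have h2 : ∀ t, 1 - h t ≤ 2 * (1 - t) ^ 2 := fun t => by
    have : 1 - h t = (1 - t) ^ 2 / (t ^ 2 + (1 - t) ^ 2) := by
      have := hpos t
      simp only [h]
      rw [eq_div_iff (by linarith), sub_mul, div_mul_cancel₀ _ (by linarith)]
      ring
    rw [this, div_le_iff₀ (by linarith [hpos t])]
    nlinarith [hpos t, sq_nonneg (1 - t)]
  have h3 : ∀ t, 0 ≤ h t := fun t => by positivity
  have h4 : ∀ t, h t ≤ 1 := fun t => by
    rw [div_le_one (by linarith [hpos t])]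
    nlinarith [sq_nonneg (1 - t)]
  clear_value h
  have e1 : cfc (fun t : ℝ => 2 * t ^ 2) y = (2 : ℂ) • (star y * y) := by
    rw [cfc_const_mul .., cfc_pow_id .., hy.star_eq, sq]
    rw [two_smul, two_smul]
  have e2 : cfc (fun t : ℝ => 2 * (1 - t) ^ 2) y = (2 : ℂ) • (star (1 - y) * (1 - y)) := by
    rw [cfc_const_mul .., cfc_pow .., cfc_sub .., cfc_const_one .., cfc_id' .., star_sub, star_one,
      hy.star_eq, sq, two_smul, two_smul]
  have e3 : cfc (fun t : ℝ => 1 - h t) y = 1 - cfc h y := by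
    rw [cfc_sub (fun _ => 1) h y (by fun_prop) hc.continuousOn, cfc_const_one ..]
  refine ⟨cfc h y, cfc_nonneg fun t _ => h3 t, cfc_le_one _ _ fun t _ => h4 t, ?_, ?_⟩
  · rw [← e1]
    exact cfc_mono fun t _ => h1 t
  · rw [← e2, ← e3]
    exact cfc_mono fun t _ => h2 t

theorem exists_effect_near_one_near_zero (ζ : E) {η : F}
    (hη : η ∈ (dominatedSubmodule hσ π)ᗮ) {ε : ℝ} (hε : 0 < ε) :
    ∃ f : A, 0 ≤ f ∧ f ≤ 1 ∧ (inner ℂ ζ (σ (1 - f) ζ)).re ≤ ε ∧ (inner ℂ η (π f η)).re ≤ ε := by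
  obtain ⟨y, hy, h1, h2⟩ := exists_selfAdjoint_near_one_near_zero hσ π ζ hη
    (Real.sqrt_pos.2 (half_pos hε))
  obtain ⟨f, hf0, hf1, hfy, hfy'⟩ := exists_effect_le hy
  have hsq : ∀ t : ℝ, 0 ≤ t → t < √(ε / 2) → 2 * t ^ 2 ≤ ε := by
    intro t ht hlt
    have h3 : t ^ 2 ≤ √(ε / 2) ^ 2 := pow_le_pow_left₀ ht hlt.le 2
    rw [Real.sq_sqrt (half_pos hε).le] at h3
    linarith
  refine ⟨f, hf0, hf1, ?_, ?_⟩
  · refine le_trans (Complex.le_def.1 (inner_rep_mono σ hfy' ζ)).1 ?_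
    rw [map_smul, smul_apply, inner_smul_right, ← rep_norm_sq]
    have h3 : σ (1 - y) ζ = -(σ y ζ - ζ) := by simp
    rw [h3, norm_neg]
    exact_mod_cast hsq _ (norm_nonneg _) h1
  · refine le_trans (Complex.le_def.1 (inner_rep_mono π hfy η)).1 ?_
    rw [map_smul, smul_apply, inner_smul_right, ← rep_norm_sq]
    exact_mod_cast hsq _ (norm_nonneg _) h2

end Effects
-- Normal functionals and the normal-plus-singular decomposition.
section NormalFunctionals

variable {H : Type*} [NormedAddCommGroup H] [InnerProductSpace ℂ H] [CompleteSpace H]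
variable {M : VonNeumannAlgebra H}

/-- The representation of `M` on the Hilbert sum of countably many copies of `H`. -/
noncomputable def stdRep (M : VonNeumannAlgebra H) :
    Elt M →⋆ₐ[ℂ] (lp (fun _ : ℕ => H) 2 →L[ℂ] lp (fun _ : ℕ => H) 2) :=
  (ContinuousLinearMap.amplification (F := H)).comp M.toStarSubalgebra.subtype

@[simp]
theorem stdRep_apply (x : Elt M) (v : lp (fun _ : ℕ => H) 2) (n : ℕ) :
    stdRep M x v n = (x : H →L[ℂ] H) (v n) := by
  simp [stdRep]

theorem isAmple_stdRep : IsAmple (stdRep M) := isAmple_amplification _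

theorem lp_hasSum_norm_sq {F : Type*} [NormedAddCommGroup F] (v : lp (fun _ : ℕ => F) 2) :
    HasSum (fun n => ‖v n‖ ^ 2) (‖v‖ ^ 2) := by
  simpa using lp.hasSum_norm (p := 2) (by norm_num) v

theorem norm_rep_apply_le {A F : Type*} [CStarAlgebra A] [NormedAddCommGroup F]
    [InnerProductSpace ℂ F] [CompleteSpace F] (π : A →⋆ₐ[ℂ] (F →L[ℂ] F)) (x : A) (v : F) :
    ‖π x v‖ ≤ ‖x‖ * ‖v‖ :=
  (π x).le_of_opNorm_le (NonUnitalStarAlgHom.norm_apply_le π x) v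

theorem isNormal_iff_exists_inner {φ : Elt M →ₗ[ℂ] ℂ} :
    IsNormal φ ↔ ∃ ξ η : lp (fun _ : ℕ => H) 2, ∀ x, φ x = inner ℂ ξ (stdRep M x η) := by
  constructor
  · rintro ⟨ξ, η, hξ, hη, h⟩
    have hmem : ∀ v : ℕ → H, Summable (fun n => ‖v n‖ ^ 2) → Memℓp v 2 := fun v hv => by
      rw [memℓp_gen_iff (by norm_num)]
      simpa using hv
    refine ⟨⟨ξ, hmem ξ hξ⟩, ⟨η, hmem η hη⟩, fun x => (h x).unique ?_⟩
    simpa using lp.hasSum_inner (𝕜 := ℂ) (⟨ξ, hmem ξ hξ⟩ : lp (fun _ : ℕ => H) 2)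
      (stdRep M x ⟨η, hmem η hη⟩)
  · rintro ⟨ξ, η, h⟩
    refine ⟨ξ, η, (lp_hasSum_norm_sq ξ).summable, (lp_hasSum_norm_sq η).summable, fun x => ?_⟩
    rw [h]
    simpa using lp.hasSum_inner (𝕜 := ℂ) ξ (stdRep M x η)

theorem IsNormal.exists_bound {φ : Elt M →ₗ[ℂ] ℂ} (hφ : IsNormal φ) :
    ∃ C : ℝ, 0 ≤ C ∧ ∀ x, ‖φ x‖ ≤ C * ‖x‖ := by
  obtain ⟨ξ, η, h⟩ := isNormal_iff_exists_inner.1 hφ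
  refine ⟨‖ξ‖ * ‖η‖, by positivity, fun x => ?_⟩
  rw [h]
  calc _ ≤ ‖ξ‖ * ‖stdRep M x η‖ := norm_inner_le_norm _ _
    _ ≤ ‖ξ‖ * (‖x‖ * ‖η‖) := by gcongr; exact norm_rep_apply_le _ _ _
    _ = _ := by ring

/-- A functional dominated by the orbit of a vector is normal. -/
theorem isNormal_of_norm_le {φ : Elt M →ₗ[ℂ] ℂ} {ζ : lp (fun _ : ℕ => H) 2} {C : ℝ}
    (h : ∀ x, ‖φ x‖ ≤ C * ‖stdRep M x ζ‖) : IsNormal φ := by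
  let W := cyclicSubspace (stdRep M) ζ
  let e : Elt M →ₗ[ℂ] W := cyclicMap (stdRep M) ζ
  have hcoe : ∀ x, (e x : lp (fun _ : ℕ => H) 2) = stdRep M x ζ := fun x => rfl
  have he : DenseRange e := denseRange_cyclicMap (stdRep M) ζ
  let g : W →L[ℂ] ℂ := φ.extendOfNorm e
  have hg : ∀ x, g (e x) = φ x := fun x => LinearMap.extendOfNorm_eq he ⟨C, h⟩ x
  refine isNormal_iff_exists_inner.2
    ⟨((InnerProductSpace.toDual ℂ W).symm g : W), ζ, fun x => ?_⟩
  rw [← hg, ← hcoe, ← Submodule.coe_inner, InnerProductSpace.toDual_symm_apply]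

theorem linearMap_ext_of_nonneg {V : Type*} [AddCommGroup V] [Module ℂ V]
    {φ ψ : Elt M →ₗ[ℂ] V} (h : ∀ x, 0 ≤ x → φ x = ψ x) : φ = ψ :=
  LinearMap.ext_on (s := {a : Elt M | 0 ≤ a}) CStarAlgebra.span_nonneg fun x hx => h x hx

/-- A positive linear functional. -/
def IsPositive (φ : Elt M →ₗ[ℂ] ℂ) : Prop := ∀ x, 0 ≤ x → 0 ≤ φ x

theorem IsPositive.mono {φ : Elt M →ₗ[ℂ] ℂ} (hφ : IsPositive φ) {x y : Elt M} (h : x ≤ y) :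
    φ x ≤ φ y := by
  have := hφ _ (sub_nonneg.2 h)
  rwa [map_sub, sub_nonneg] at this

theorem IsPositive.re_mono {φ : Elt M →ₗ[ℂ] ℂ} (hφ : IsPositive φ) {x y : Elt M} (h : x ≤ y) :
    (φ x).re ≤ (φ y).re := (Complex.le_def.1 (hφ.mono h)).1

theorem IsPositive.re_nonneg {φ : Elt M →ₗ[ℂ] ℂ} (hφ : IsPositive φ) {x : Elt M} (h : 0 ≤ x) :
    0 ≤ (φ x).re := (Complex.le_def.1 (hφ x h)).1

theorem IsPositive.eq_ofReal_re {φ : Elt M →ₗ[ℂ] ℂ} (hφ : IsPositive φ) {x : Elt M} (h : 0 ≤ x) :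
    φ x = ((φ x).re : ℂ) := Complex.eq_re_of_ofReal_le (r := 0) (by simpa using hφ x h)

theorem IsNormalState.isPositive {ρ : Elt M →ₗ[ℂ] ℂ} (hρ : IsNormalState ρ) : IsPositive ρ := by
  intro x hx
  obtain ⟨s, rfl⟩ := CStarAlgebra.nonneg_iff_eq_star_mul_self.1 hx
  exact hρ.nonneg s

/-- The bundled positive functional. -/
noncomputable def IsPositive.toPositiveLinearMap {φ : Elt M →ₗ[ℂ] ℂ} (hφ : IsPositive φ) :
    Elt M →ₚ[ℂ] ℂ := PositiveLinearMap.mk₀ φ hφ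

/-- The cyclic vector of the GNS representation. -/
noncomputable def IsPositive.gnsVector {φ : Elt M →ₗ[ℂ] ℂ} (hφ : IsPositive φ) :
    hφ.toPositiveLinearMap.GNS :=
  ((hφ.toPositiveLinearMap.toPreGNS 1 : hφ.toPositiveLinearMap.PreGNS) :
    hφ.toPositiveLinearMap.GNS)

theorem IsPositive.eq_inner_gns {φ : Elt M →ₗ[ℂ] ℂ} (hφ : IsPositive φ) (x : Elt M) :
    φ x = inner ℂ hφ.gnsVector (hφ.toPositiveLinearMap.gnsStarAlgHom x hφ.gnsVector) := by
  have h1 : hφ.toPositiveLinearMap.gnsStarAlgHom x hφ.gnsVector =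
      ((hφ.toPositiveLinearMap.toPreGNS x : hφ.toPositiveLinearMap.PreGNS) :
        hφ.toPositiveLinearMap.GNS) := by
    change hφ.toPositiveLinearMap.gnsNonUnitalStarAlgHom x hφ.gnsVector = _
    rw [IsPositive.gnsVector, PositiveLinearMap.gnsNonUnitalStarAlgHom_apply_coe]
    simp
  rw [h1, IsPositive.gnsVector, UniformSpace.Completion.inner_coe,
    PositiveLinearMap.preGNS_inner_def, PositiveLinearMap.ofPreGNS_toPreGNS,
    PositiveLinearMap.ofPreGNS_toPreGNS, star_one, one_mul]
  rfl

/-- A positive normal functional is a vector functional. -/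
theorem IsNormal.exists_vector {φ : Elt M →ₗ[ℂ] ℂ} (hn : IsNormal φ) (hp : IsPositive φ) :
    ∃ ζ : lp (fun _ : ℕ => H) 2, ∀ x, φ x = inner ℂ ζ (stdRep M x ζ) := by
  obtain ⟨ξ, η, h⟩ := isNormal_iff_exists_inner.1 hn
  obtain ⟨Z, hZ⟩ := (isAmple_stdRep (M := M)).merge ξ η
  -- `φ (x* x) = ⟪x ξ, x η⟫` is at most `‖x ξ‖² + ‖x η‖² = ‖x Z‖²`, so the GNS vector is dominated
  -- by `Z`.
  have h1 : ∀ x, ‖hp.toPositiveLinearMap.gnsStarAlgHom x hp.gnsVector‖ ≤ ‖stdRep M x Z‖ := by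
    intro x
    refine (sq_le_sq₀ (norm_nonneg _) (norm_nonneg _)).1 ?_
    have h2 := rep_norm_sq hp.toPositiveLinearMap.gnsStarAlgHom x hp.gnsVector
    rw [← hp.eq_inner_gns, h, rep_mul_apply, ← rep_inner_left] at h2
    have h3 : ‖hp.toPositiveLinearMap.gnsStarAlgHom x hp.gnsVector‖ ^ 2 =
        ‖inner ℂ (stdRep M x ξ) (stdRep M x η)‖ := by
      rw [← h2]; simp
    rw [h3, hZ]
    nlinarith [norm_inner_le_norm (𝕜 := ℂ) (stdRep M x ξ) (stdRep M x η),
      sq_nonneg (‖stdRep M x ξ‖ - ‖stdRep M x η‖), sq_nonneg (‖stdRep M x ξ‖ + ‖stdRep M x η‖)]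
  obtain ⟨ζ, hζ⟩ := exists_norm_eq (stdRep M) hp.toPositiveLinearMap.gnsStarAlgHom h1
  refine ⟨ζ, fun x => ?_⟩
  let ω : Elt M →ₗ[ℂ] ℂ := (innerSL ℂ ζ).toLinearMap ∘ₗ orbitMap (stdRep M) ζ
  suffices φ = ω from congrArg (fun f : Elt M →ₗ[ℂ] ℂ => f x) this
  refine linearMap_ext_of_nonneg fun y hy => ?_
  obtain ⟨s, rfl⟩ := CStarAlgebra.nonneg_iff_eq_star_mul_self.1 hy
  rw [hp.eq_inner_gns, ← rep_norm_sq, hζ, rep_norm_sq]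
  rfl

/-- Split `ξ` along the dominated subspace and its complement; both are invariant, so the cross
terms vanish. Singularity of `ψs` is expressed in the form used later: below `y` there is an `x`
that a given normal functional hardly distinguishes from `y`, while `ψs` is almost zero on it. With
`y = s* s`, the witness is `s* f s` for an effect `f` near one on `s ζ` and near zero on `s ξs`. -/
theorem exists_normal_add_singular_of_rep {F : Type*} [NormedAddCommGroup F]
    [InnerProductSpace ℂ F] [CompleteSpace F] (π : Elt M →⋆ₐ[ℂ] (F →L[ℂ] F)) (ξ : F)
    {ψ : Elt M →ₗ[ℂ] ℂ} (hψ : ∀ x, ψ x = inner ℂ ξ (π x ξ)) :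
    ∃ ψn ψs : Elt M →ₗ[ℂ] ℂ, ψ = ψn + ψs ∧ IsNormal ψn ∧ IsPositive ψn ∧ IsPositive ψs ∧
      ∀ y : Elt M, 0 ≤ y → ∀ ω : Elt M →ₗ[ℂ] ℂ, IsNormal ω → IsPositive ω → ∀ ε : ℝ, 0 < ε →
        ∃ x : Elt M, 0 ≤ x ∧ x ≤ y ∧ (ω (y - x)).re ≤ ε ∧ (ψs x).re ≤ ε := by
  have hσ : IsAmple (stdRep M) := isAmple_stdRep
  let K := dominatedSubmodule hσ π
  obtain ⟨ξn, hξn, ξs, hξs, h1⟩ : ∃ ξn ∈ K, ∃ ξs ∈ Kᗮ, ξ = ξn + ξs :=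
    ⟨K.starProjection ξ, Submodule.starProjection_apply_mem K ξ, ξ - K.starProjection ξ,
      Submodule.sub_starProjection_mem_orthogonal ξ, (add_sub_cancel _ _).symm⟩
  let vec : F → (Elt M →ₗ[ℂ] ℂ) := fun v =>
    (innerSL ℂ v).toLinearMap ∘ₗ orbitMap π v
  have hvec : ∀ v x, vec v x = inner ℂ v (π x v) := fun v x => rfl
  have hvpos : ∀ v, IsPositive (vec v) := fun v x hx => inner_rep_nonneg π hx v
  refine ⟨vec ξn, vec ξs, ?_, ?_, hvpos _, hvpos _, ?_⟩
  · ext x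
    have h2 : inner ℂ ξn (π x ξs) = 0 := (Submodule.mem_orthogonal K _).1
      (rep_mem_dominatedSubmodule_orthogonal hσ π x hξs) ξn hξn
    have h3 : inner ℂ ξs (π x ξn) = 0 := (Submodule.mem_orthogonal' K _).1 hξs _
      (rep_mem_dominatedSubmodule hσ π x hξn)
    rw [hψ x, LinearMap.add_apply, hvec, hvec]
    rw [h1, map_add, inner_add_left, inner_add_right, inner_add_right, h2, h3]
    ring
  · obtain ⟨ζ, hζ⟩ := hξn
    refine isNormal_of_norm_le (ζ := ζ) (C := ‖ξn‖) fun x => ?_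
    rw [hvec]
    exact (norm_inner_le_norm _ _).trans (mul_le_mul_of_nonneg_left (hζ x) (norm_nonneg _))
  · intro y hy ω hωn hωp ε hε
    obtain ⟨s, rfl⟩ := CStarAlgebra.nonneg_iff_eq_star_mul_self.1 hy
    obtain ⟨ζ, hζ⟩ := hωn.exists_vector hωp
    obtain ⟨f, hf0, hf1, h1, h2⟩ := exists_effect_near_one_near_zero hσ π
      (stdRep M s ζ) (rep_mem_dominatedSubmodule_orthogonal hσ π s hξs) hε
    refine ⟨star s * f * s, star_left_conjugate_nonneg hf0 s, ?_, ?_, ?_⟩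
    · simpa using star_left_conjugate_le_conjugate hf1 s
    · have : star s * s - star s * f * s = star s * ((1 - f) * s) := by noncomm_ring
      rw [this, hζ, rep_mul_apply, ← rep_inner_left, rep_mul_apply]
      exact h1
    · rw [hvec, mul_assoc, rep_mul_apply, ← rep_inner_left, rep_mul_apply]
      exact h2

/-- Every positive functional is the sum of a normal one and a singular one. -/
theorem exists_normal_add_singular {ψ : Elt M →ₗ[ℂ] ℂ} (hψ : IsPositive ψ) :
    ∃ ψn ψs : Elt M →ₗ[ℂ] ℂ, ψ = ψn + ψs ∧ IsNormal ψn ∧ IsPositive ψn ∧ IsPositive ψs ∧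
      ∀ y : Elt M, 0 ≤ y → ∀ ω : Elt M →ₗ[ℂ] ℂ, IsNormal ω → IsPositive ω → ∀ ε : ℝ, 0 < ε →
        ∃ x : Elt M, 0 ≤ x ∧ x ≤ y ∧ (ω (y - x)).re ≤ ε ∧ (ψs x).re ≤ ε :=
  exists_normal_add_singular_of_rep _ _ hψ.eq_inner_gns

end NormalFunctionals
-- Duality with the predual and weak-* compactness.
section Predual

variable {H : Type*} [NormedAddCommGroup H] [InnerProductSpace ℂ H] [CompleteSpace H]
variable {M : VonNeumannAlgebra H}

/-- The functional `x ↦ ⟪ξ, x η⟫` of two square-summable sequences of vectors. -/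
noncomputable def seqFunctional (M : VonNeumannAlgebra H) (ξ η : lp (fun _ : ℕ => H) 2) :
    Elt M →ₗ[ℂ] ℂ := (innerSL ℂ ξ).toLinearMap ∘ₗ orbitMap (stdRep M) η

theorem seqFunctional_apply (ξ η : lp (fun _ : ℕ => H) 2) (x : Elt M) :
    seqFunctional M ξ η x = inner ℂ ξ (stdRep M x η) := rfl

theorem isNormal_seqFunctional (ξ η : lp (fun _ : ℕ => H) 2) : IsNormal (seqFunctional M ξ η) :=
  isNormal_iff_exists_inner.2 ⟨ξ, η, fun _ => rfl⟩

theorem isPositive_seqFunctional (ζ : lp (fun _ : ℕ => H) 2) :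
    IsPositive (seqFunctional M ζ ζ) := fun _ hx => inner_rep_nonneg (stdRep M) hx ζ

theorem norm_seqFunctional_le (ξ η : lp (fun _ : ℕ => H) 2) (x : Elt M) :
    ‖seqFunctional M ξ η x‖ ≤ ‖ξ‖ * ‖η‖ * ‖x‖ := by
  rw [seqFunctional_apply]
  calc _ ≤ ‖ξ‖ * ‖stdRep M x η‖ := norm_inner_le_norm _ _
    _ ≤ ‖ξ‖ * (‖x‖ * ‖η‖) := by gcongr; exact norm_rep_apply_le _ _ _
    _ = _ := by ring

/-- The functional `x ↦ ⟪a, x b⟫`. -/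
noncomputable def vectorFunctional (M : VonNeumannAlgebra H) (a b : H) : Elt M →ₗ[ℂ] ℂ :=
  seqFunctional M (lp.single 2 0 a) (lp.single 2 0 b)

theorem stdRep_single (x : Elt M) (j : ℕ) (b : H) :
    stdRep M x (lp.single 2 j b) = lp.single 2 j ((x : H →L[ℂ] H) b) := by
  ext n
  rw [stdRep_apply, lp.single_apply, lp.single_apply]
  by_cases h : n = j
  · subst h; simp
  · simp [h]

theorem vectorFunctional_apply (a b : H) (x : Elt M) :
    vectorFunctional M a b x = inner ℂ a ((x : H →L[ℂ] H) b) := by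
  rw [vectorFunctional, seqFunctional_apply, stdRep_single, lp.inner_single_left,
    lp.single_apply_self]

theorem isNormal_vectorFunctional (a b : H) : IsNormal (vectorFunctional M a b) :=
  isNormal_seqFunctional _ _

theorem isPositive_vectorFunctional (a : H) : IsPositive (vectorFunctional M a a) :=
  isPositive_seqFunctional _

theorem norm_vectorFunctional_le (a b : H) (x : Elt M) :
    ‖vectorFunctional M a b x‖ ≤ ‖a‖ * ‖b‖ * ‖x‖ := by
  have := norm_seqFunctional_le (lp.single 2 0 a) (lp.single 2 0 b) x
  rwa [lp.norm_single (by norm_num), lp.norm_single (by norm_num)] at this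

theorem norm_le_of_forall_vectorFunctional {x : Elt M} {C : ℝ} (hC : 0 ≤ C)
    (h : ∀ a b : H, ‖vectorFunctional M a b x‖ ≤ C * (‖a‖ * ‖b‖)) : ‖x‖ ≤ C := by
  refine ContinuousLinearMap.opNorm_le_bound (x : H →L[ℂ] H) hC fun b => ?_
  have h1 := h ((x : H →L[ℂ] H) b) b
  rw [vectorFunctional_apply, inner_self_eq_norm_sq_to_K] at h1
  simp only [norm_pow, RCLike.norm_ofReal, abs_norm] at h1
  rcases (norm_nonneg ((x : H →L[ℂ] H) b)).eq_or_lt with h0 | h0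
  · rw [← h0]; positivity
  · refine le_of_mul_le_mul_left ?_ h0
    nlinarith

theorem nonneg_of_forall_vectorFunctional {x : Elt M}
    (h : ∀ a : H, 0 ≤ vectorFunctional M a a x) : 0 ≤ x := by
  change 0 ≤ (x : H →L[ℂ] H)
  rw [ContinuousLinearMap.nonneg_iff_isPositive, ContinuousLinearMap.isPositive_iff']
  have key : ∀ a, 0 ≤ inner ℂ a ((x : H →L[ℂ] H) a) := fun a => by
    rw [← vectorFunctional_apply]; exact h a
  have key' : ∀ a, 0 ≤ inner ℂ ((x : H →L[ℂ] H) a) a := fun a => by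
    rw [← inner_conj_symm, (key a).isSelfAdjoint.conj_eq]
    exact key a
  refine ⟨?_, key'⟩
  rw [ContinuousLinearMap.isSelfAdjoint_iff_isSymmetric,
    LinearMap.isSymmetric_iff_inner_map_self_real]
  intro a
  exact (key' a).isSelfAdjoint.conj_eq

theorem eq_of_forall_normal {x y : Elt M} (h : ∀ φ : Elt M →ₗ[ℂ] ℂ, IsNormal φ → φ x = φ y) :
    x = y := by
  refine Subtype.ext (ContinuousLinearMap.ext fun b => ext_inner_left ℂ fun a => ?_)
  have := h _ (isNormal_vectorFunctional a b)
  rwa [vectorFunctional_apply, vectorFunctional_apply] at this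

/-- `M` is the dual of its predual. -/
theorem exists_forall_normal_eq (Λ : (Elt M →ₗ[ℂ] ℂ) → ℂ)
    (hadd : ∀ φ ψ, IsNormal φ → IsNormal ψ → Λ (φ + ψ) = Λ φ + Λ ψ)
    (hsmul : ∀ (c : ℂ) φ, IsNormal φ → Λ (c • φ) = c * Λ φ) (C : ℝ)
    (hbound : ∀ ξ η, ‖Λ (seqFunctional M ξ η)‖ ≤ C * ‖ξ‖ * ‖η‖) :
    ∃ y : Elt M, ∀ φ, IsNormal φ → φ y = Λ φ := by
  let B₀ : lp (fun _ : ℕ => H) 2 →ₗ⋆[ℂ] lp (fun _ : ℕ => H) 2 →ₗ[ℂ] ℂ :=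
    LinearMap.mk₂'ₛₗ (starRingEnd ℂ) (RingHom.id ℂ) (fun ξ η => Λ (seqFunctional M ξ η))
      (fun ξ ξ' η => by
        rw [← hadd _ _ (isNormal_seqFunctional _ _) (isNormal_seqFunctional _ _)]
        congr 1; ext x; simp [seqFunctional_apply])
      (fun c ξ η => by
        rw [smul_eq_mul, ← hsmul _ _ (isNormal_seqFunctional _ _)]
        congr 1; ext x; simp [seqFunctional_apply, mul_comm])
      (fun ξ η η' => by
        rw [← hadd _ _ (isNormal_seqFunctional _ _) (isNormal_seqFunctional _ _)]
        congr 1; ext x; simp [seqFunctional_apply])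
      (fun c ξ η => by
        rw [smul_eq_mul, ← hsmul _ _ (isNormal_seqFunctional _ _)]
        congr 1; ext x; simp [seqFunctional_apply])
  let B := B₀.mkContinuous₂ C hbound
  -- `Y` represents `Λ` on the amplified space, and `y` below is its corner in the copy with index
  -- `0`. Moving `u` from one side of `x` to the other inside `Λ` shows that `y` commutes with the
  -- commutant. Off-diagonal blocks of `Y` come from zero functionals and the diagonal blocks all
  -- agree, so `Y` is the amplification of `y`.
  let Y := (InnerProductSpace.continuousLinearMapOfBilin B).adjoint
  have hY : ∀ ξ η, inner ℂ ξ (Y η) = Λ (seqFunctional M ξ η) := fun ξ η => by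
    rw [ContinuousLinearMap.adjoint_inner_right,
      InnerProductSpace.continuousLinearMapOfBilin_apply]
    rfl
  let S : H →L[ℂ] lp (fun _ : ℕ => H) 2 := lp.singleContinuousLinearMap ℂ (fun _ : ℕ => H) 2 0
  let y : H →L[ℂ] H := S.adjoint ∘L Y ∘L S
  have hy : ∀ a b, inner ℂ a (y b) = Λ (vectorFunctional M a b) := fun a b => by
    simp only [y, ContinuousLinearMap.comp_apply, ContinuousLinearMap.adjoint_inner_right, hY]
    rfl
  have hyM : y ∈ M.toStarSubalgebra := by
    refine mem_of_forall_commutant fun u hu => ContinuousLinearMap.ext fun b =>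
      ext_inner_left ℂ fun a => ?_
    change inner ℂ a (u (y b)) = inner ℂ a (y (u b))
    rw [← ContinuousLinearMap.adjoint_inner_left, hy, hy]
    congr 1
    ext x
    rw [vectorFunctional_apply, vectorFunctional_apply, ContinuousLinearMap.adjoint_inner_left,
      commutant_comm_apply hu]
  have hamp : stdRep M ⟨y, hyM⟩ = Y := by
    refine lp.ext_continuousLinearMap (by norm_num) fun j => ContinuousLinearMap.ext fun b => ?_
    change stdRep M ⟨y, hyM⟩ (lp.single 2 j b) = Y (lp.single 2 j b)
    rw [stdRep_single]
    ext i
    refine ext_inner_left ℂ fun a => ?_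
    have h1 := lp.inner_single_left (𝕜 := ℂ) i a (Y (lp.single 2 j b))
    rw [← h1, hY]
    by_cases hij : i = j
    · subst hij
      rw [lp.single_apply_self]
      change inner ℂ a (y b) = _
      rw [hy]
      congr 1
      ext x
      rw [vectorFunctional_apply, seqFunctional_apply, stdRep_single, lp.inner_single_left,
        lp.single_apply_self]
    · rw [lp.single_apply_ne _ _ _ hij, inner_zero_right]
      have h2 : seqFunctional M (lp.single 2 i a) (lp.single 2 j b) = 0 := by
        ext x
        rw [seqFunctional_apply, stdRep_single, lp.inner_single_left, lp.single_apply_ne _ _ _ hij,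
          inner_zero_right, LinearMap.zero_apply]
      have h3 := hsmul 0 _ (isNormal_seqFunctional (lp.single 2 i a) (lp.single 2 j b))
      rw [zero_smul, zero_mul] at h3
      rw [h2, h3]
  refine ⟨⟨y, hyM⟩, fun φ hφ => ?_⟩
  obtain ⟨ξ, η, h⟩ := isNormal_iff_exists_inner.1 hφ
  have h1 : φ = seqFunctional M ξ η := LinearMap.ext h
  rw [h1, seqFunctional_apply, hamp, hY]

/-- Bounded families have weak-* limits along ultrafilters. -/
theorem exists_ultrafilter_limit {T : Type*} (U : Ultrafilter T) (x : T → Elt M) {C : ℝ}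
    (hx : ∀ t, ‖x t‖ ≤ C) :
    ∃ y : Elt M, ∀ φ : Elt M →ₗ[ℂ] ℂ, IsNormal φ →
      Filter.Tendsto (fun t => φ (x t)) U (nhds (φ y)) := by
  have hC : ∀ φ : Elt M →ₗ[ℂ] ℂ, IsNormal φ →
      ∃ z : ℂ, Filter.Tendsto (fun t => φ (x t)) U (nhds z) := by
    intro φ hφ
    obtain ⟨D, hD, hb⟩ := hφ.exists_bound
    obtain ⟨z, -, hz⟩ := (isCompact_closedBall (0 : ℂ) (D * C)).ultrafilter_le_nhds
      (U.map fun t => φ (x t)) (by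
        simp only [Ultrafilter.coe_map, Filter.le_principal_iff, Filter.mem_map]
        refine Filter.univ_mem' fun t => ?_
        simp only [Set.mem_preimage, mem_closedBall_zero_iff]
        exact (hb _).trans (mul_le_mul_of_nonneg_left (hx t) hD))
    exact ⟨z, hz⟩
  let Λ : (Elt M →ₗ[ℂ] ℂ) → ℂ := fun φ => (U : Filter T).limUnder fun t => φ (x t)
  have hΛ : ∀ φ, IsNormal φ → Filter.Tendsto (fun t => φ (x t)) U (nhds (Λ φ)) := fun φ h =>
    tendsto_nhds_limUnder (hC φ h)
  obtain ⟨y, hy⟩ := exists_forall_normal_eq Λ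
    (fun φ ψ h1 h2 => ((hΛ φ h1).add (hΛ ψ h2)).limUnder_eq)
    (fun c φ h => ((hΛ φ h).const_mul c).limUnder_eq) C
    (fun ξ η => le_of_tendsto' (hΛ _ (isNormal_seqFunctional ξ η)).norm fun t => by
      refine (norm_seqFunctional_le ξ η (x t)).trans ?_
      nlinarith [mul_le_mul_of_nonneg_left (hx t) (mul_nonneg (norm_nonneg ξ) (norm_nonneg η))])
  exact ⟨y, fun φ hφ => by rw [hy φ hφ]; exact hΛ φ hφ⟩

end Predual

/-! ### Integrals over almost equal sets. -/

section SetIntegrals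

open MeasureTheory

variable {G : Type*} [MeasurableSpace G] {m : Measure G}

theorem norm_average_le {K : Set G} (hK : m K < ∞) {f : G → ℂ} {C : ℝ} (hC0 : 0 ≤ C)
    (hC : ∀ g, ‖f g‖ ≤ C) : ‖((m.real K)⁻¹ : ℝ) • ∫ g in K, f g ∂m‖ ≤ C := by
  rw [norm_smul, Real.norm_of_nonneg (by positivity)]
  have h1 := norm_setIntegral_le_of_norm_le_const hK fun g (_ : g ∈ K) => hC g
  rcases (measureReal_nonneg (μ := m) (s := K)).eq_or_lt with h0 | h0
  · rw [← h0]; simpa using hC0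
  · rw [inv_mul_le_iff₀ h0, mul_comm]; exact h1

/-- Here `S` stands for a translate of a Følner set, an image whose measurability is not assumed. It
is replaced by its measurable hull, which changes neither the restricted measure nor the measure of
`S \ K`. -/
theorem norm_setIntegral_sub_le {K S : Set G} (hK : MeasurableSet K) (hKm : m K < ∞)
    (hS : m S < ∞) {f : G → ℂ} (hf : Measurable f) {C : ℝ} (hC0 : 0 ≤ C)
    (hC : ∀ g, ‖f g‖ ≤ C) :
    ‖∫ g in S, f g ∂m - ∫ g in K, f g ∂m‖ ≤ C * m.real (symmDiff K S) := by
  set T := toMeasurable m S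
  have hT : MeasurableSet T := measurableSet_toMeasurable _ _
  have hTm : m T < ∞ := by rwa [measure_toMeasurable]
  have hres : m.restrict T = m.restrict S := Measure.restrict_toMeasurable hS.ne
  have hint : ∀ R : Set G, m R < ∞ → IntegrableOn f R m := fun R hR => by
    have : IsFiniteMeasure (m.restrict R) := ⟨by simpa using hR⟩
    exact Integrable.of_bound (C := C) hf.aestronglyMeasurable (.of_forall hC)
  have h1 : m (T \ K) = m (S \ K) := by
    have h2 := congrArg (fun μ : Measure G => μ Kᶜ) hres
    simp only [Measure.restrict_apply hK.compl] at h2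
    rwa [Set.inter_comm, ← Set.sdiff_eq, Set.inter_comm, ← Set.sdiff_eq] at h2
  have h3 : m (K \ T) ≤ m (K \ S) :=
    measure_mono (Set.sdiff_subset_sdiff_right (subset_toMeasurable m S))
  have hsymm : m (symmDiff K S) = m (K \ S) + m (S \ K) := by
    rw [← measure_inter_add_sdiff (symmDiff K S) hK]
    congr 2 <;> ext g <;> simp only [Set.mem_inter_iff, Set.mem_symmDiff, Set.mem_sdiff] <;> tauto
  have hKS : m (K \ S) < ∞ := (measure_mono Set.sdiff_subset).trans_lt hKm
  have hSK : m (S \ K) < ∞ := (measure_mono Set.sdiff_subset).trans_lt hS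
  rw [← hres, ← integral_inter_add_sdiff hK (hint T hTm), ← integral_inter_add_sdiff hT (hint K hKm),
    Set.inter_comm T K, add_sub_add_left_eq_sub]
  refine (norm_sub_le _ _).trans ?_
  have i1 := norm_setIntegral_le_of_norm_le_const (μ := m) (s := T \ K) (h1 ▸ hSK) fun g _ => hC g
  have i2 := norm_setIntegral_le_of_norm_le_const (μ := m) (s := K \ T) (h3.trans_lt hKS)
    fun g _ => hC g
  have e1 : m.real (T \ K) = m.real (S \ K) := by rw [measureReal_def, h1, measureReal_def]
  have e2 : m.real (K \ T) ≤ m.real (K \ S) := ENNReal.toReal_mono hKS.ne h3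
  have e3 : m.real (symmDiff K S) = m.real (K \ S) + m.real (S \ K) := by
    rw [measureReal_def, hsymm, ENNReal.toReal_add hKS.ne hSK.ne]; rfl
  rw [e3]
  rw [e1] at i1
  nlinarith [mul_le_mul_of_nonneg_left e2 hC0]

end SetIntegrals

/-! ### Weak-* averages. -/

section Averages

open MeasureTheory

variable {H : Type*} [NormedAddCommGroup H] [InnerProductSpace ℂ H] [CompleteSpace H]
variable {M : VonNeumannAlgebra H} {G : Type*} {α : G → (Elt M →L[ℂ] Elt M)}

theorem IsAverage.unique [MeasurableSpace G] {m : Measure G} {K : Set G} {x y z : Elt M}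
    (hy : IsAverage α m K x y) (hz : IsAverage α m K x z) : y = z :=
  eq_of_forall_normal fun φ hφ => by rw [hy φ hφ, hz φ hφ]

variable [Semigroup G] [TopologicalSpace G]

theorem IsDynamicalSystem.norm_apply_le (hα : IsDynamicalSystem α) (g : G) (x : Elt M) :
    ‖α g x‖ ≤ ‖x‖ := by
  simpa using (α g).le_of_opNorm_le (hα.contraction g) x

theorem IsAverage.nonneg [MeasurableSpace G] {m : Measure G} (hα : IsDynamicalSystem α)
    {K : Set G} {x y : Elt M} (hy : IsAverage α m K x y) (hx : 0 ≤ x) : 0 ≤ y := by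
  refine nonneg_of_forall_vectorFunctional fun a => ?_
  rw [hy _ (isNormal_vectorFunctional a a)]
  refine smul_nonneg (by positivity) (integral_nonneg fun g => ?_)
  exact isPositive_vectorFunctional a _ (hα.positive g x hx)

theorem IsAverage.norm_le [MeasurableSpace G] {m : Measure G} (hα : IsDynamicalSystem α)
    {K : Set G} (hK : m K < ∞) {x y : Elt M} (hy : IsAverage α m K x y) : ‖y‖ ≤ ‖x‖ := by
  refine norm_le_of_forall_vectorFunctional (norm_nonneg x) fun a b => ?_
  rw [hy _ (isNormal_vectorFunctional a b)]
  refine norm_average_le hK (by positivity) fun g => ?_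
  refine (norm_vectorFunctional_le a b _).trans ?_
  rw [mul_comm]
  exact mul_le_mul_of_nonneg_right (hα.norm_apply_le g x) (by positivity)

variable [MeasurableSpace G] [BorelSpace G] {m : Measure G}

theorem IsDynamicalSystem.integrableOn (hα : IsDynamicalSystem α) {K : Set G} (hK : m K < ∞)
    (x : Elt M) {φ : Elt M →ₗ[ℂ] ℂ} (hφ : IsNormal φ) :
    IntegrableOn (fun g => φ (α g x)) K m := by
  obtain ⟨C, hC0, hC⟩ := hφ.exists_bound
  have : IsFiniteMeasure (m.restrict K) := ⟨by simpa using hK⟩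
  refine Integrable.of_bound (C := C * ‖x‖)
    (hα.continuous x φ hφ).measurable.aestronglyMeasurable (.of_forall fun g => ?_)
  exact (hC _).trans (mul_le_mul_of_nonneg_left (hα.norm_apply_le g x) hC0)

theorem exists_isAverage (hα : IsDynamicalSystem α) {K : Set G} (hK : m K < ∞) (x : Elt M) :
    ∃ y : Elt M, IsAverage α m K x y := by
  refine exists_forall_normal_eq
    (fun φ => ((m.real K)⁻¹ : ℝ) • ∫ g in K, φ (α g x) ∂m) (fun φ ψ hφ hψ => ?_)
    (fun c φ hφ => ?_) ‖x‖ (fun ξ η => ?_)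
  · simp only [LinearMap.add_apply]
    rw [integral_add (hα.integrableOn hK x hφ) (hα.integrableOn hK x hψ), smul_add]
  · simp only [LinearMap.smul_apply, smul_eq_mul]
    rw [integral_const_mul, mul_smul_comm]
  · refine norm_average_le hK (by positivity) fun g => ?_
    refine (norm_seqFunctional_le ξ η _).trans ?_
    nlinarith [mul_le_mul_of_nonneg_left (hα.norm_apply_le g x)
      (mul_nonneg (norm_nonneg ξ) (norm_nonneg η))]

theorem exists_averageMap (hα : IsDynamicalSystem α) {K : Set G} (hK : m K < ∞) :
    ∃ A : Elt M →ₗ[ℂ] Elt M, ∀ x, IsAverage α m K x (A x) := by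
  choose A hA using exists_isAverage (m := m) hα hK
  refine ⟨⟨⟨A, fun x y => ?_⟩, fun c x => ?_⟩, hA⟩
  · refine (hA (x + y)).unique fun φ hφ => ?_
    simp only [map_add]
    rw [integral_add (hα.integrableOn hK x hφ) (hα.integrableOn hK y hφ), smul_add, hA x φ hφ,
      hA y φ hφ]
  · refine (hA (c • x)).unique fun φ hφ => ?_
    simp only [RingHom.id_apply, map_smul, smul_eq_mul]
    rw [integral_const_mul, hA x φ hφ, mul_smul_comm]

end Averages
-- Asymptotic invariance of the averages.
section Asymptotics

open MeasureTheory Filter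

variable {H : Type*} [NormedAddCommGroup H] [InnerProductSpace ℂ H] [CompleteSpace H]
variable {M : VonNeumannAlgebra H} {G : Type*} [MeasurableSpace G] {m : Measure G}
  {α : G → (Elt M →L[ℂ] Elt M)} {ι : Type*} [Preorder ι] {K : ι → Set G}

/-- The composition law of an action or an anti-action, with the invariance of the measure and of
the Følner net under the corresponding translations. -/
structure IsComposition [TopologicalSpace G] (α : G → (Elt M →L[ℂ] Elt M)) (m : Measure G)
    (K : ι → Set G) (c : G → G → G) : Prop where
  continuous : Continuous fun p : G × G => c p.1 p.2
  apply_apply : ∀ (g h : G) (x : Elt M), α g (α h x) = α (c g h) x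
  measure_image : ∀ (h : G) (B : Set G), MeasurableSet B → m ((fun g => c g h) '' B) = m B
  tendsto : ∀ h : G, Tendsto
    (fun i => m (symmDiff (K i) ((fun g => c g h) '' K i)) / m (K i)) atTop (nhds 0)

theorem IsDynamicalSystem.exists_isComposition [Semigroup G] [TopologicalSpace G] [ContinuousMul G]
    (hα : IsDynamicalSystem α) (hm : IsBiinvariant m) (hK : IsFolnerNet m K) :
    ∃ c, IsComposition α m K c := by
  rcases hα.action with h | h
  · exact ⟨fun g h => g * h, continuous_mul, h, fun u B hB => (hm u B hB).2, hK.right⟩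
  · exact ⟨fun g h => h * g, continuous_snd.mul continuous_fst, h, fun u B hB => (hm u B hB).1,
      hK.left⟩

variable [TopologicalSpace G] [BorelSpace G]

/-- Invariance under images suffices, without injectivity of the translation: the image of `B ∩ f⁻¹
S` is `f(B) ∩ S`, so the restriction of `m` to `B` is pushed to its restriction to the image. -/
theorem IsComposition.setIntegral_comp {c : G → G → G} (hc : IsComposition α m K c) (h : G)
    {B : Set G} (hB : MeasurableSet B) {f : G → ℂ} (hf : Measurable f) :
    ∫ g in B, f (c g h) ∂m = ∫ g in (fun g => c g h) '' B, f g ∂m := by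
  have hmeas : Measurable fun g => c g h :=
    (hc.continuous.comp (continuous_id.prodMk continuous_const)).measurable
  have hmap : (m.restrict B).map (fun g => c g h) = m.restrict ((fun g => c g h) '' B) := by
    ext S hS
    rw [Measure.map_apply hmeas hS, Measure.restrict_apply (hmeas hS), Measure.restrict_apply hS,
      ← hc.measure_image h _ ((hmeas hS).inter hB), Set.image_preimage_inter]
  rw [← hmap, integral_map hmeas.aemeasurable hf.aestronglyMeasurable]

variable [Semigroup G]

theorem IsComposition.norm_average_sub_le {c : G → G → G} (hc : IsComposition α m K c)
    (hα : IsDynamicalSystem α) {B : Set G} (hB : MeasurableSet B) (hBm : m B < ∞) (h : G)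
    {x y z : Elt M} (hy : IsAverage α m B x y) (hz : IsAverage α m B (α h x) z) :
    ‖z - y‖ ≤ ‖x‖ * (m (symmDiff B ((fun g => c g h) '' B)) / m B).toReal := by
  refine norm_le_of_forall_vectorFunctional (by positivity) fun a b => ?_
  rw [map_sub, hy _ (isNormal_vectorFunctional a b), hz _ (isNormal_vectorFunctional a b),
    ← smul_sub]
  have hmeas : Measurable fun g => vectorFunctional M a b (α g x) :=
    (hα.continuous x _ (isNormal_vectorFunctional a b)).measurable
  simp only [hc.apply_apply]
  rw [hc.setIntegral_comp h hB hmeas, norm_smul, Real.norm_of_nonneg (by positivity),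
    ENNReal.toReal_div]
  have hS : m ((fun g => c g h) '' B) < ∞ := by rwa [hc.measure_image h B hB]
  have h1 := norm_setIntegral_sub_le hB hBm hS hmeas (C := ‖a‖ * ‖b‖ * ‖x‖) (by positivity)
    fun g => (norm_vectorFunctional_le a b _).trans
      (mul_le_mul_of_nonneg_left (hα.norm_apply_le g x) (by positivity))
  refine (mul_le_mul_of_nonneg_left h1 (by positivity)).trans_eq ?_
  rw [measureReal_def, measureReal_def, div_eq_mul_inv]
  ring

theorem IsComposition.tendsto_average_sub {c : G → G → G} (hc : IsComposition α m K c)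
    (hα : IsDynamicalSystem α) (hK : IsFolnerNet m K) {A : ι → Elt M →ₗ[ℂ] Elt M}
    (hA : ∀ i x, IsAverage α m (K i) x (A i x)) (h : G) (x : Elt M) :
    Tendsto (fun i => ‖A i (α h x) - A i x‖) atTop (nhds 0) := by
  refine squeeze_zero (fun _ => norm_nonneg _) (fun i => hc.norm_average_sub_le hα
    (hK.measurable i) (hK.finite i) h (hA i x) (hA i (α h x))) ?_
  have := ((ENNReal.tendsto_toReal ENNReal.zero_ne_top).comp (hc.tendsto h)).const_mul ‖x‖
  simpa using this

variable [SecondCountableTopology G]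

theorem IsComposition.continuous_average {c : G → G → G} (hc : IsComposition α m K c)
    (hα : IsDynamicalSystem α) {B : Set G} (hBm : m B < ∞) {A : Elt M →ₗ[ℂ] Elt M}
    (hA : ∀ x, IsAverage α m B x (A x)) (x : Elt M) {φ : Elt M →ₗ[ℂ] ℂ} (hφ : IsNormal φ) :
    Continuous fun h => φ (A (α h x)) := by
  obtain ⟨C, hC0, hC⟩ := hφ.exists_bound
  have : IsFiniteMeasure (m.restrict B) := ⟨by simpa using hBm⟩
  simp only [hA _ φ hφ, hc.apply_apply]
  have hF := hα.continuous x φ hφ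
  have hcont : Continuous fun h => ∫ g in B, φ (α (c g h) x) ∂m := ?_
  · exact hcont.const_smul (m.real B)⁻¹
  refine continuous_of_dominated (μ := m.restrict B) (bound := fun _ => C * ‖x‖) (fun h => ?_)
    (fun h => .of_forall fun g => ?_) (integrable_const _) (.of_forall fun g => ?_)
  · exact (hF.comp (hc.continuous.comp
      (continuous_id.prodMk continuous_const))).measurable.aestronglyMeasurable
  · exact (hC _).trans (mul_le_mul_of_nonneg_left (hα.norm_apply_le _ x) hC0)
  · exact hF.comp (hc.continuous.comp (continuous_const.prodMk continuous_id))

/-- Fubini takes `A` under the weak-* integral without any appeal to normality of `A`; only the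
normality of each `α g` enters. -/
theorem IsComposition.average_average {c : G → G → G} (hc : IsComposition α m K c)
    (hα : IsDynamicalSystem α) {B B' : Set G} (hBm : m B < ∞) (hBm' : m B' < ∞)
    {A A' : Elt M →ₗ[ℂ] Elt M}
    (hA : ∀ x, IsAverage α m B x (A x)) (hA' : ∀ x, IsAverage α m B' x (A' x)) (x : Elt M)
    {φ : Elt M →ₗ[ℂ] ℂ} (hφ : IsNormal φ) :
    φ (A (A' x)) = ((m.real B')⁻¹ : ℝ) • ∫ h in B', φ (A (α h x)) ∂m := by
  obtain ⟨C, hC0, hC⟩ := hφ.exists_bound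
  have : IsFiniteMeasure (m.restrict B) := ⟨by simpa using hBm⟩
  have : IsFiniteMeasure (m.restrict B') := ⟨by simpa using hBm'⟩
  have h1 : ∀ g, φ (α g (A' x)) = ((m.real B')⁻¹ : ℝ) • ∫ h in B', φ (α (c g h) x) ∂m := fun g => by
    have := hA' x _ (hα.normal g φ hφ)
    simp only [LinearMap.comp_apply, ContinuousLinearMap.coe_coe, hc.apply_apply] at this
    exact this
  rw [hA _ φ hφ]
  simp only [h1, hA _ φ hφ, hc.apply_apply]
  rw [integral_smul, integral_smul, smul_comm, integral_integral_swap]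
  have hF : Continuous fun p : G × G => φ (α (c p.1 p.2) x) :=
    (hα.continuous x φ hφ).comp hc.continuous
  refine Integrable.of_bound (C := C * ‖x‖) hF.measurable.aestronglyMeasurable
    (.of_forall fun p => ?_)
  exact (hC _).trans (mul_le_mul_of_nonneg_left (hα.norm_apply_le _ x) hC0)

/-- The norm is bounded by the mean over `h ∈ K j` of `D i h`, which is bounded and tends to `0` for
each `h`. Dominated convergence applies since `atTop` is countably generated. -/
theorem IsComposition.tendsto_average_average_sub [(atTop : Filter ι).IsCountablyGenerated]
    {c : G → G → G} (hc : IsComposition α m K c)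
    (hα : IsDynamicalSystem α) (hK : IsFolnerNet m K) {A : ι → Elt M →ₗ[ℂ] Elt M}
    (hA : ∀ i x, IsAverage α m (K i) x (A i x)) (j : ι) (x : Elt M) :
    Tendsto (fun i => ‖A i (A j x) - A i x‖) atTop (nhds 0) := by
  have : IsFiniteMeasure (m.restrict (K j)) := ⟨by simpa using hK.finite j⟩
  let D : ι → G → ℝ := fun i h => ‖A i (α h x) - A i x‖
  have hpos : 0 < m.real (K j) := ENNReal.toReal_pos (hK.pos j).ne' (hK.finite j).ne
  have hAn : ∀ i y, ‖A i y‖ ≤ ‖y‖ := fun i y => (hA i y).norm_le hα (hK.finite i)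
  have hDb : ∀ i h, ‖D i h‖ ≤ 2 * ‖x‖ := fun i h => by
    rw [norm_norm]
    linarith [norm_sub_le (A i (α h x)) (A i x), hAn i (α h x), hAn i x, hα.norm_apply_le h x]
  -- A norm is a supremum of moduli of matrix coefficients, which are continuous in `h`. Hence `D i`
  -- is lower semicontinuous: its sublevel sets are closed.
  have hDm : ∀ i, Measurable (D i) := by
    intro i
    refine measurable_of_Iic fun r => ?_
    rcases lt_or_ge r 0 with hr | hr
    · convert MeasurableSet.empty
      ext h
      simp only [Set.mem_preimage, Set.mem_Iic, Set.mem_empty_iff_false, iff_false, not_le]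
      exact hr.trans_le (norm_nonneg _)
    · have : D i ⁻¹' Set.Iic r = ⋂ p : H × H, {h | ‖vectorFunctional M p.1 p.2
          (A i (α h x) - A i x)‖ ≤ r * (‖p.1‖ * ‖p.2‖)} := by
        ext h
        simp only [Set.mem_preimage, Set.mem_Iic, Set.mem_iInter, Set.mem_ofPred_eq]
        constructor
        · intro hle p
          refine (norm_vectorFunctional_le p.1 p.2 _).trans ?_
          rw [mul_comm]
          exact mul_le_mul_of_nonneg_right hle (by positivity)
        · exact fun hle => norm_le_of_forall_vectorFunctional hr fun a b => hle (a, b)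
      rw [this]
      refine IsClosed.measurableSet (isClosed_iInter fun p => isClosed_le ?_ continuous_const)
      simp only [map_sub]
      exact ((hc.continuous_average hα (hK.finite i) (hA i) x
        (isNormal_vectorFunctional p.1 p.2)).sub continuous_const).norm
  have hDi : ∀ i, IntegrableOn (D i) (K j) m := fun i =>
    Integrable.of_bound (C := 2 * ‖x‖) (hDm i).aestronglyMeasurable (.of_forall (hDb i))
  have hle : ∀ i, ‖A i (A j x) - A i x‖ ≤ (m.real (K j))⁻¹ * ∫ h in K j, D i h ∂m := by
    intro i
    have hnn : 0 ≤ ∫ h in K j, D i h ∂m := integral_nonneg fun h => norm_nonneg _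
    refine norm_le_of_forall_vectorFunctional (by positivity) fun a b => ?_
    have hn := isNormal_vectorFunctional (M := M) a b
    have e : vectorFunctional M a b (A i (A j x) - A i x) = ((m.real (K j))⁻¹ : ℝ) •
        ∫ h in K j, vectorFunctional M a b (A i (α h x) - A i x) ∂m := by
      simp only [map_sub]
      have hint : IntegrableOn (fun h => vectorFunctional M a b (A i (α h x))) (K j) m := by
        refine Integrable.of_bound (C := ‖a‖ * ‖b‖ * ‖x‖) (hc.continuous_average hα (hK.finite i)
          (hA i) x hn).measurable.aestronglyMeasurable (.of_forall fun h => ?_)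
        exact (norm_vectorFunctional_le a b _).trans (mul_le_mul_of_nonneg_left
          ((hAn i _).trans (hα.norm_apply_le h x)) (by positivity))
      rw [integral_sub hint (integrable_const _), smul_sub,
        ← hc.average_average hα (hK.finite i) (hK.finite j) (hA i) (hA j) x hn]
      congr 1
      rw [setIntegral_const, smul_smul, inv_mul_cancel₀ hpos.ne', one_smul]
    rw [e, norm_smul, Real.norm_of_nonneg (by positivity), mul_assoc]
    refine mul_le_mul_of_nonneg_left ?_ (by positivity)
    rw [← integral_mul_const]
    refine norm_integral_le_of_norm_le ((hDi i).mul_const _) (.of_forall fun h => ?_)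
    rw [mul_comm]
    exact norm_vectorFunctional_le a b _
  refine squeeze_zero (fun _ => norm_nonneg _) hle ?_
  have hlim : Tendsto (fun i => ∫ h in K j, D i h ∂m) atTop (nhds (∫ _ in K j, (0 : ℝ) ∂m)) :=
    tendsto_integral_filter_of_dominated_convergence (fun _ => 2 * ‖x‖)
      (.of_forall fun i => (hDm i).aestronglyMeasurable)
      (.of_forall fun i => .of_forall (hDb i)) (integrable_const _)
      (.of_forall fun h => hc.tendsto_average_sub hα hK hA h x)
  simpa using hlim.const_mul (m.real (K j))⁻¹

/-- The averages of a dynamical system over a Følner net. -/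
structure IsAveraging (α : G → (Elt M →L[ℂ] Elt M)) (m : Measure G) (K : ι → Set G)
    (A : ι → Elt M →ₗ[ℂ] Elt M) : Prop where
  isAverage : ∀ i x, IsAverage α m (K i) x (A i x)
  norm_le : ∀ i x, ‖A i x‖ ≤ ‖x‖
  nonneg : ∀ i x, 0 ≤ x → 0 ≤ A i x
  tendsto_translate : ∀ g x, Tendsto (fun i => ‖A i (α g x) - A i x‖) atTop (nhds 0)
  tendsto_average : ∀ j x, Tendsto (fun i => ‖A i (A j x) - A i x‖) atTop (nhds 0)

theorem exists_isAveraging [ContinuousMul G] [(atTop : Filter ι).IsCountablyGenerated]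
    (hα : IsDynamicalSystem α) (hm : IsBiinvariant m) (hK : IsFolnerNet m K) :
    ∃ A, IsAveraging α m K A := by
  obtain ⟨c, hc⟩ := hα.exists_isComposition hm hK
  choose A hA using fun i => exists_averageMap hα (hK.finite i)
  exact ⟨A, hA, fun i x => (hA i x).norm_le hα (hK.finite i), fun i x => (hA i x).nonneg hα,
    hc.tendsto_average_sub hα hK hA, hc.tendsto_average_average_sub hα hK hA⟩

end Asymptotics
-- Hahn–Banach separation by a positive functional.
section Separation

variable {H : Type*} [NormedAddCommGroup H] [InnerProductSpace ℂ H] [CompleteSpace H]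
variable {M : VonNeumannAlgebra H}

theorem exists_positive_separating {T : Elt M →ₗ[ℂ] Elt M} (hT : ∀ x, 0 ≤ x → 0 ≤ T x)
    {S : Set (Elt M)} (hS : Convex ℝ S) (hne : S.Nonempty) (hS0 : ∀ x ∈ S, 0 ≤ x) {ε : ℝ}
    (hε : 0 < ε) (hle : ∀ x ∈ S, ε ≤ ‖T x‖) :
    ∃ μ : Elt M →ₗ[ℂ] ℂ, IsPositive μ ∧ (∀ v, ‖μ v‖ ≤ 2 * ‖v‖) ∧ ∀ x ∈ S, ε ≤ (μ (T x)).re := by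
  -- The image of `S` is enlarged upwards and by arbitrary imaginary parts. This forces the
  -- separating functional to be nonnegative on positive elements and real on self-adjoint ones,
  -- while monotonicity of the norm keeps the set away from the ball.
  let t : Set (Elt M) := {w | ∃ x ∈ S, T x ≤ (realPart w : Elt M)}
  have htc : Convex ℝ t := by
    rintro w₁ ⟨x₁, hx₁, h₁⟩ w₂ ⟨x₂, hx₂, h₂⟩ a b ha hb hab
    refine ⟨a • x₁ + b • x₂, hS hx₁ hx₂ ha hb hab, ?_⟩
    have e : T (a • x₁ + b • x₂) = a • T x₁ + b • T x₂ := by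
      rw [map_add, T.map_smul_of_tower, T.map_smul_of_tower]
    rw [e, map_add, map_smul, map_smul]
    exact add_le_add (smul_le_smul_of_nonneg_left h₁ ha) (smul_le_smul_of_nonneg_left h₂ hb)
  have hdisj : Disjoint (Metric.ball (0 : Elt M) ε) t := by
    rw [Set.disjoint_left]
    rintro w hw ⟨x, hx, hxw⟩
    rw [mem_ball_zero_iff] at hw
    have h1 := CStarAlgebra.norm_le_norm_of_nonneg_of_le (hT x (hS0 x hx)) hxw
    have h2 : ‖(realPart w : Elt M)‖ ≤ ‖w‖ := realPart.norm_le w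
    linarith [hle x hx]
  obtain ⟨f, u, hf1, hf2⟩ := RCLike.geometric_hahn_banach_open (𝕜 := ℂ)
    (convex_ball (0 : Elt M) ε) Metric.isOpen_ball htc hdisj
  have hu : 0 < u := by simpa using hf1 0 (Metric.mem_ball_self hε)
  obtain ⟨x₀, hx₀⟩ := hne
  have hTsa : ∀ x ∈ S, (realPart (T x) : Elt M) = T x := fun x hx =>
    (hT x (hS0 x hx)).isSelfAdjoint.coe_realPart
  have hmul : ∀ (s : ℝ) (z : Elt M), RCLike.re (f (T x₀ + s • z)) =
      RCLike.re (f (T x₀)) + s * RCLike.re (f z) := fun s z => by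
    rw [map_add, map_add, ← Complex.coe_smul, map_smul, Complex.coe_smul, RCLike.smul_re]
  have hre : ∀ z : Elt M, 0 ≤ z → 0 ≤ RCLike.re (f z) := by
    intro z hz
    by_contra hneg
    push Not at hneg
    have key : ∀ s : ℝ, 0 ≤ s → u ≤ RCLike.re (f (T x₀)) + s * RCLike.re (f z) := by
      intro s hs
      rw [← hmul]
      refine hf2 _ ⟨x₀, hx₀, ?_⟩
      have h1 : (realPart z : Elt M) = z := hz.isSelfAdjoint.coe_realPart
      rw [map_add, map_smul]
      change _ ≤ (realPart (T x₀) : Elt M) + s • (realPart z : Elt M)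
      rw [hTsa x₀ hx₀, h1]
      exact le_add_of_nonneg_right (smul_nonneg hs hz)
    have h0 := key 0 le_rfl
    have h1 := key ((RCLike.re (f (T x₀))) / (-RCLike.re (f z)))
      (div_nonneg (by linarith) (by linarith))
    have h2 : RCLike.re (f (T x₀)) / (-RCLike.re (f z)) * RCLike.re (f z) =
        -RCLike.re (f (T x₀)) := by
      rw [div_neg, neg_mul, div_mul_cancel₀ _ hneg.ne]
    linarith
  have him : ∀ k : Elt M, IsSelfAdjoint k → RCLike.re (f (Complex.I • k)) = 0 := by
    intro k hk
    by_contra hne0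
    have key : ∀ s : ℝ, u ≤ RCLike.re (f (T x₀)) + s * RCLike.re (f (Complex.I • k)) := by
      intro s
      rw [← hmul]
      refine hf2 _ ⟨x₀, hx₀, ?_⟩
      have h1 : (realPart (Complex.I • k) : Elt M) = 0 := by
        rw [realPart_I_smul, hk.imaginaryPart, neg_zero]; rfl
      rw [map_add, map_smul]
      change _ ≤ (realPart (T x₀) : Elt M) + s • (realPart (Complex.I • k) : Elt M)
      rw [h1, smul_zero, add_zero, hTsa x₀ hx₀]
    have h1 := key (-(RCLike.re (f (T x₀))) / RCLike.re (f (Complex.I • k)))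
    rw [div_mul_cancel₀ _ hne0] at h1
    linarith
  -- The open ball is tested at radius `ε / 2`, after rotating `v` so that `f v` is real; this is
  -- the origin of the constant `2`.
  have hbound : ∀ v, ‖f v‖ * ε ≤ 2 * u * ‖v‖ := by
    intro v
    rcases eq_or_ne v 0 with rfl | hv
    · simp
    have hvn : 0 < ‖v‖ := norm_pos_iff.2 hv
    obtain ⟨c, hc1, hc2⟩ := RCLike.exists_norm_eq_mul_self (f v)
    have h1 := hf1 ((((ε / 2) / ‖v‖ : ℝ) : ℂ) • c • v) (by
      rw [mem_ball_zero_iff, norm_smul, norm_smul, hc1, Complex.norm_real,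
        Real.norm_of_nonneg (by positivity), one_mul, div_mul_cancel₀ _ hvn.ne']
      linarith)
    have h2 : f ((((ε / 2) / ‖v‖ : ℝ) : ℂ) • c • v) = ((ε / 2 / ‖v‖ * ‖f v‖ : ℝ) : ℂ) := by
      rw [(f : Elt M →L[ℂ] ℂ).map_smul, (f : Elt M →L[ℂ] ℂ).map_smul, smul_eq_mul, smul_eq_mul,
        ← hc2, Complex.ofReal_mul]
      rfl
    rw [h2] at h1
    have h3 : ε / 2 / ‖v‖ * ‖f v‖ < u := by simpa using h1
    rw [div_mul_eq_mul_div, div_lt_iff₀ hvn] at h3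
    linarith
  refine ⟨((ε / u : ℝ) : ℂ) • (f : Elt M →ₗ[ℂ] ℂ), fun z hz => ?_, fun v => ?_, fun x hx => ?_⟩
  · have h1 : f z = ((RCLike.re (f z) : ℝ) : ℂ) := by
      have h2 := him z hz.isSelfAdjoint
      rw [map_smul, smul_eq_mul] at h2
      apply Complex.ext
      · simp
      · simpa using h2
    change 0 ≤ ((ε / u : ℝ) : ℂ) * f z
    rw [h1, ← Complex.ofReal_mul]
    have := hre z hz
    rw [Complex.zero_le_real]
    positivity
  · change ‖((ε / u : ℝ) : ℂ) * f v‖ ≤ _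
    rw [norm_mul, Complex.norm_real, Real.norm_of_nonneg (by positivity), div_mul_eq_mul_div,
      div_le_iff₀ hu]
    linarith [hbound v]
  · have h1 := hf2 (T x) ⟨x, hx, (hTsa x hx).ge⟩
    change ε ≤ (((ε / u : ℝ) : ℂ) * f (T x)).re
    rw [Complex.re_ofReal_mul, div_mul_eq_mul_div, le_div_iff₀ hu]
    exact mul_le_mul_of_nonneg_left h1 hε.le

end Separation
-- Weakly wandering operators below a given positive operator.
section Wandering

open MeasureTheory Filter

variable {H : Type*} [NormedAddCommGroup H] [InnerProductSpace ℂ H] [CompleteSpace H]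
variable {M : VonNeumannAlgebra H}

/-- Apply the inequality to `‖x‖ • 1 - x` to obtain its reverse at `x`. -/
theorem IsPositive.eq_of_le_of_map_one_le {φ ψ : Elt M →ₗ[ℂ] ℂ} (hφ : IsPositive φ)
    (hψ : IsPositive ψ) (hle : ∀ x, 0 ≤ x → (φ x).re ≤ (ψ x).re) (hone : (ψ 1).re ≤ (φ 1).re) :
    φ = ψ := by
  refine linearMap_ext_of_nonneg fun x hx => ?_
  rw [hφ.eq_ofReal_re hx, hψ.eq_ofReal_re hx]
  refine congrArg _ (le_antisymm (hle x hx) ?_)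
  have h1 : x ≤ ((‖x‖ : ℝ) : ℂ) • (1 : Elt M) := by
    have := IsSelfAdjoint.le_algebraMap_norm_self (a := x) hx.isSelfAdjoint
    rwa [Algebra.algebraMap_eq_smul_one, ← Complex.coe_smul] at this
  have h2 := hle _ (sub_nonneg.2 h1)
  simp only [map_sub, map_smul, smul_eq_mul, Complex.sub_re, Complex.re_ofReal_mul] at h2
  nlinarith [norm_nonneg x]

variable {G : Type*} {α : G → (Elt M →L[ℂ] Elt M)}

/-- With `ω = ψn ∘ α g` and `x'` below `x` almost carrying `ω` while almost null for `ψs`, one gets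
`ω x ≈ ω x' ≤ ψ (α g x') = ψ x' ≲ ψn x`, so `ω ≤ ψn`. Since `α g 1 ≤ 1`, the singular part cannot
grow at `1`, so `ψn` cannot decrease there, and equality follows. -/
theorem exists_invariant_normal_add_singular [Semigroup G] [TopologicalSpace G]
    (hα : IsDynamicalSystem α) {ψ : Elt M →ₗ[ℂ] ℂ} (hψ : IsPositive ψ)
    (hinv : ∀ g x, ψ (α g x) = ψ x) :
    ∃ ψn ψs : Elt M →ₗ[ℂ] ℂ, ψ = ψn + ψs ∧ IsNormal ψn ∧ IsPositive ψn ∧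
      (∀ g x, ψn (α g x) = ψn x) ∧
      ∀ y : Elt M, 0 ≤ y → ∀ ω : Elt M →ₗ[ℂ] ℂ, IsNormal ω → IsPositive ω → ∀ ε : ℝ, 0 < ε →
        ∃ x : Elt M, 0 ≤ x ∧ x ≤ y ∧ (ω (y - x)).re ≤ ε ∧ (ψs x).re ≤ ε := by
  obtain ⟨ψn, ψs, rfl, hn, hnp, hsp, hsing⟩ := exists_normal_add_singular hψ
  refine ⟨ψn, ψs, rfl, hn, hnp, fun g => ?_, hsing⟩
  let ω : Elt M →ₗ[ℂ] ℂ := ψn ∘ₗ (α g : Elt M →ₗ[ℂ] Elt M)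
  have hωn : IsNormal ω := hα.normal g ψn hn
  have hωp : IsPositive ω := fun x hx => hnp _ (hα.positive g x hx)
  have hre : ∀ x, (ψn (α g x)).re + (ψs (α g x)).re = (ψn x).re + (ψs x).re := fun x => by
    have := congrArg Complex.re (hinv g x)
    simpa using this
  suffices ω = ψn from fun x => congrArg (fun f : Elt M →ₗ[ℂ] ℂ => f x) this
  refine hωp.eq_of_le_of_map_one_le hnp (fun x hx => le_of_forall_pos_le_add fun ε hε => ?_) ?_
  · obtain ⟨x', hx0, hxx, h1, h2⟩ := hsing x hx ω hωn hωp (ε / 2) (half_pos hε)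
    have h3 : (ω x).re = (ω (x - x')).re + (ψn (α g x')).re := by
      rw [map_sub, Complex.sub_re]
      change _ = _ - (ω x').re + (ω x').re
      ring
    have h4 := hsp.re_nonneg (hα.positive g x' hx0)
    linarith [hre x', hnp.re_mono hxx]
  · have h1 := hnp.re_mono (hα.subunital g)
    have h2 := hsp.re_mono (hα.subunital g)
    change _ ≤ (ψn (α g 1)).re
    linarith [hre 1]

variable [MeasurableSpace G] {m : Measure G} {ι : Type*} [Preorder ι] {K : ι → Set G}
  {A : ι → Elt M →ₗ[ℂ] Elt M}

/-- `ψ` is the limit of `μ i ∘ A i` along an ultrafilter finer than `atTop`. Invariance holds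
because `A i (α g x) - A i x` tends to `0` in norm and the `μ i` are uniformly bounded. -/
theorem IsAveraging.exists_invariant_limit [TopologicalSpace G] [Nonempty ι] [IsDirectedOrder ι]
    (hA : IsAveraging α m K A) {μ : ι → Elt M →ₗ[ℂ] ℂ} (hμ : ∀ i, IsPositive (μ i))
    (hb : ∀ i v, ‖μ i v‖ ≤ 2 * ‖v‖) :
    ∃ ψ : Elt M →ₗ[ℂ] ℂ, IsPositive ψ ∧ (∀ g x, ψ (α g x) = ψ x) ∧
      ∀ x c, (∀ i, c ≤ (μ i (A i x)).re) → c ≤ (ψ x).re := by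
  let U : Ultrafilter ι := Ultrafilter.of atTop
  have hU : (U : Filter ι) ≤ atTop := Ultrafilter.of_le atTop
  have hex : ∀ x, ∃ z : ℂ, Tendsto (fun i => μ i (A i x)) U (nhds z) := by
    intro x
    obtain ⟨z, -, hz⟩ := (isCompact_closedBall (0 : ℂ) (2 * ‖x‖)).ultrafilter_le_nhds
      (U.map fun i => μ i (A i x)) (by
        simp only [Ultrafilter.coe_map, Filter.le_principal_iff, Filter.mem_map]
        refine Filter.univ_mem' fun i => ?_
        simp only [Set.mem_preimage, mem_closedBall_zero_iff]
        exact (hb _ _).trans (mul_le_mul_of_nonneg_left (hA.norm_le i x) (by norm_num)))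
    exact ⟨z, hz⟩
  choose ψ hψ using hex
  refine ⟨⟨⟨ψ, fun x y => ?_⟩, fun c x => ?_⟩, fun x hx => ?_, fun g x => ?_, fun x c hc => ?_⟩
  · refine tendsto_nhds_unique (hψ (x + y)) ?_
    simpa using (hψ x).add (hψ y)
  · refine tendsto_nhds_unique (hψ (c • x)) ?_
    simpa using (hψ x).const_mul c
  · exact ge_of_tendsto' (hψ x) fun i => hμ i _ (hA.nonneg i x hx)
  · refine sub_eq_zero.1 (tendsto_nhds_unique ((hψ (α g x)).sub (hψ x)) ?_)
    have h1 := ((hA.tendsto_translate g x).mono_left hU).const_mul 2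
    rw [mul_zero] at h1
    refine squeeze_zero_norm (fun i => ?_) h1
    rw [← map_sub]
    exact hb i _
  · exact ge_of_tendsto' ((Complex.continuous_re.tendsto _).comp (hψ x)) hc

theorem IsAveraging.exists_norm_average_lt [Semigroup G] [TopologicalSpace G] [Nonempty ι]
    [IsDirectedOrder ι] (hα : IsDynamicalSystem α) (hA : IsAveraging α m K A) {y : Elt M}
    (hy0 : 0 ≤ y) (hy : ∀ θ : Elt M →ₗ[ℂ] ℂ, IsNormal θ → IsPositive θ →
      (∀ g x, θ (α g x) = θ x) → θ y = 0)
    {φ : Elt M →ₗ[ℂ] ℂ} (hφn : IsNormal φ) (hφp : IsPositive φ) {δ ε : ℝ} (hδ : 0 < δ)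
    (hε : 0 < ε) : ∃ i x, 0 ≤ x ∧ x ≤ y ∧ (φ (y - x)).re ≤ δ ∧ ‖A i x‖ < ε := by
  by_contra! hcon
  let S : Set (Elt M) := {x | 0 ≤ x ∧ x ≤ y ∧ (φ (y - x)).re ≤ δ}
  have hS : Convex ℝ S := by
    rintro x₁ ⟨h1, h2, h3⟩ x₂ ⟨k1, k2, k3⟩ a b ha hb hab
    refine ⟨add_nonneg (smul_nonneg ha h1) (smul_nonneg hb k1), ?_, ?_⟩
    · calc a • x₁ + b • x₂ ≤ a • y + b • y :=
          add_le_add (smul_le_smul_of_nonneg_left h2 ha) (smul_le_smul_of_nonneg_left k2 hb)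
        _ = y := by rw [← add_smul, hab, one_smul]
    · have e : y - (a • x₁ + b • x₂) = (a : ℂ) • (y - x₁) + (b : ℂ) • (y - x₂) := by
        rw [Complex.coe_smul, Complex.coe_smul, smul_sub, smul_sub]
        nth_rewrite 1 [← one_smul ℝ y]
        rw [← hab, add_smul]
        abel
      rw [e, map_add, map_smul, map_smul, Complex.add_re, smul_eq_mul, smul_eq_mul,
        Complex.re_ofReal_mul, Complex.re_ofReal_mul]
      nlinarith
  have hyS : y ∈ S := ⟨hy0, le_rfl, by simpa using hδ.le⟩
  choose μ hμp hμb hμS using fun i => exists_positive_separating (hA.nonneg i) hS ⟨y, hyS⟩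
    (fun x hx => hx.1) hε (fun x hx => hcon i x hx.1 hx.2.1 hx.2.2)
  obtain ⟨ψ, hψp, hψinv, hψ⟩ := hA.exists_invariant_limit hμp hμb
  obtain ⟨ψn, ψs, rfl, hnn, hnp, hninv, hsing⟩ :=
    exists_invariant_normal_add_singular hα hψp hψinv
  -- The bound `δ` keeps `x` in `S`, where `ψ ≥ ε`; but `ψn x ≤ ψn y = 0` and `ψs x ≤ ε / 2`.
  obtain ⟨x, hx0, hxy, hx1, hx2⟩ := hsing y hy0 φ hφn hφp (min δ (ε / 2))
    (lt_min hδ (half_pos hε))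
  have h1 := hψ x ε fun i => hμS i x ⟨hx0, hxy, hx1.trans (min_le_left _ _)⟩
  have h2 := hnp.re_mono hxy
  rw [hy ψn hnn hnp hninv] at h2
  rw [LinearMap.add_apply, Complex.add_re] at h1
  have h3 := hx2.trans (min_le_right _ _)
  simp only [Complex.zero_re] at h2
  linarith

theorem IsAveraging.exists_weaklyWandering_le [Semigroup G] [TopologicalSpace G] [Nonempty ι]
    [IsDirectedOrder ι] (hα : IsDynamicalSystem α) (hA : IsAveraging α m K A) {y : Elt M}
    (hy0 : 0 ≤ y) (hy : ∀ θ : Elt M →ₗ[ℂ] ℂ, IsNormal θ → IsPositive θ →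
      (∀ g x, θ (α g x) = θ x) → θ y = 0)
    {φ : Elt M →ₗ[ℂ] ℂ} (hφn : IsNormal φ) (hφp : IsPositive φ) (hφy : 0 < (φ y).re) :
    ∃ x, IsWeaklyWandering α m K x ∧ x ≤ y ∧ x ≠ 0 := by
  have step : ∀ (k : ℕ) (z : {z : Elt M // 0 ≤ z ∧ z ≤ y}), ∃ (i : ι)
      (x : {z : Elt M // 0 ≤ z ∧ z ≤ y}), (x : Elt M) ≤ z ∧
        (φ (z - x : Elt M)).re ≤ (φ y).re * (1 / 2) ^ (k + 2) ∧
        ‖A i (x : Elt M)‖ < 1 / ((k : ℝ) + 1) := by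
    rintro k ⟨z, hz0, hzy⟩
    obtain ⟨i, x, hx0, hxz, h1, h2⟩ := hA.exists_norm_average_lt hα hz0 (fun θ hn hp hi => by
        refine le_antisymm ?_ (hp z hz0)
        rw [← hy θ hn hp hi]
        exact hp.mono hzy) hφn hφp (δ := (φ y).re * (1 / 2) ^ (k + 2))
      (ε := 1 / ((k : ℝ) + 1)) (by positivity) (by positivity)
    exact ⟨i, ⟨x, hx0, hxz.trans hzy⟩, hxz, h1, h2⟩
  choose I f hfle hfφ hfA using step
  let s : ℕ → {z : Elt M // 0 ≤ z ∧ z ≤ y} := fun n => Nat.rec ⟨y, hy0, le_rfl⟩ (fun k z => f k z) n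
  have hs : ∀ k, s (k + 1) = f k (s k) := fun k => rfl
  have hanti : Antitone fun n : ℕ => (s n).1 := antitone_nat_of_succ_le fun n => hfle n (s n)
  -- The loss at step `k` is at most `φ y / 2 ^ (k + 2)`; this is the exact sum of the first `n`
  -- bounds, and at least half of `φ y` always remains.
  have hφs : ∀ n : ℕ, (φ y).re * (1 / 2 + (1 / 2) ^ (n + 1)) ≤ (φ (s n).1).re := by
    intro n
    induction n with
    | zero =>
      change _ ≤ (φ y).re
      norm_num
    | succ n ih =>
      have h1 := hfφ n (s n)
      rw [map_sub, Complex.sub_re, ← hs] at h1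
      have h2 : (1 / 2 : ℝ) ^ (n + 1) = 2 * (1 / 2) ^ (n + 2) := by ring
      rw [h2] at ih
      have h3 : (1 / 2 : ℝ) ^ (n + 1 + 1) = (1 / 2) ^ (n + 2) := rfl
      rw [h3]
      nlinarith
  let U : Ultrafilter ℕ := Filter.hyperfilter ℕ
  have hU : (U : Filter ℕ) ≤ atTop := Nat.hyperfilter_le_atTop
  obtain ⟨x, hx⟩ := exists_ultrafilter_limit U (fun n => (s n).1) (C := ‖y‖)
    fun n => CStarAlgebra.norm_le_norm_of_nonneg_of_le (s n).2.1 (s n).2.2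
  have hx0 : 0 ≤ x := nonneg_of_forall_vectorFunctional fun a =>
    ge_of_tendsto' (hx _ (isNormal_vectorFunctional a a)) fun n =>
      isPositive_vectorFunctional a _ (s n).2.1
  have hxs : ∀ n, x ≤ (s n).1 := fun n => sub_nonneg.1 <|
      nonneg_of_forall_vectorFunctional fun a => by
    rw [map_sub, sub_nonneg]
    refine le_of_tendsto (hx _ (isNormal_vectorFunctional a a)) ?_
    filter_upwards [hU (eventually_ge_atTop n)] with k hk
    exact (isPositive_vectorFunctional a).mono (hanti hk)
  have hxA : ∀ k : ℕ, ‖A (I k (s k)) x‖ < 1 / ((k : ℝ) + 1) := fun k => by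
    refine lt_of_le_of_lt ?_ (hfA k (s k))
    rw [← hs]
    refine CStarAlgebra.norm_le_norm_of_nonneg_of_le (hA.nonneg _ _ hx0) ?_
    have := hA.nonneg (I k (s k)) _ (sub_nonneg.2 (hxs (k + 1)))
    rwa [map_sub, sub_nonneg] at this
  have hlim : Tendsto (fun i => ‖A i x‖) atTop (nhds 0) := by
    rw [Metric.tendsto_nhds]
    intro ε hε
    obtain ⟨k, hk⟩ := exists_nat_one_div_lt (half_pos hε)
    -- A single good index controls all late ones: `A i x` is close to `A i (A j x)`, whose norm is
    -- at most `‖A j x‖`.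
    have h1 := Metric.tendsto_nhds.1 (hA.tendsto_average (I k (s k)) x) (ε / 2) (half_pos hε)
    filter_upwards [h1] with i hi
    rw [dist_zero_right, norm_norm] at hi ⊢
    have h2 := hA.norm_le i (A (I k (s k)) x)
    have h3 := norm_sub_le (A i (A (I k (s k)) x)) (A i (A (I k (s k)) x) - A i x)
    rw [sub_sub_cancel] at h3
    linarith [hxA k]
  refine ⟨x, ⟨hx0, fun i => A i x, fun i => hA.isAverage i x, hlim⟩, hxs 0, ?_⟩
  rintro rfl
  have h1 : (φ y).re * (1 / 2) ≤ (φ (0 : Elt M)).re := by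
    refine ge_of_tendsto' ((Complex.continuous_re.tendsto _).comp (hx φ hφn)) fun n => ?_
    refine le_trans ?_ (hφs n)
    have : (0 : ℝ) ≤ (1 / 2) ^ (n + 1) := by positivity
    nlinarith
  rw [map_zero, Complex.zero_re] at h1
  linarith

end Wandering
-- Support projections and `σ`-finiteness.
section Supports

variable {H : Type*} [NormedAddCommGroup H] [InnerProductSpace ℂ H] [CompleteSpace H]
variable {M : VonNeumannAlgebra H}

/-- Every set of vectors has a support projection in `M`. -/
theorem exists_projection_of_set (M : VonNeumannAlgebra H) (S : Set H) :
    ∃ e : Elt M, IsStarProjection e ∧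
      ∀ x : Elt M, x * e = 0 ↔ ∀ s ∈ S, (x : H →L[ℂ] H) s = 0 := by
  -- `W` is invariant under the commutant, so its projection belongs to `M`.
  let W : Submodule ℂ H :=
    ⨅ x : {x : Elt M // ∀ s ∈ S, (x : H →L[ℂ] H) s = 0}, ((x : Elt M) : H →L[ℂ] H).ker
  have hW : ∀ η, η ∈ W ↔ ∀ x : Elt M, (∀ s ∈ S, (x : H →L[ℂ] H) s = 0) →
      (x : H →L[ℂ] H) η = 0 := fun η => by
    simp [W, Submodule.mem_iInf]
  have hclosed : IsClosed (W : Set H) := by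
    rw [Submodule.coe_iInf]
    exact isClosed_iInter fun x => ContinuousLinearMap.isClosed_ker _
  have : CompleteSpace W := hclosed.completeSpace_coe
  have hproj : IsStarProjection W.starProjection := isStarProjection_starProjection
  have hmem : W.starProjection ∈ M := by
    rw [VonNeumannAlgebra.IsStarProjection.mem_iff hproj]
    intro u hu
    rw [Submodule.range_starProjection, Module.End.mem_invtSubmodule]
    intro η hη
    refine (hW _).2 fun x hx => ?_
    change (x : H →L[ℂ] H) (u η) = 0
    rw [commutant_comm_apply hu, (hW η).1 hη x hx, map_zero]
  refine ⟨⟨W.starProjection, hmem⟩, ⟨Subtype.ext hproj.1, Subtype.ext hproj.2⟩, fun x => ?_⟩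
  have hx : x * (⟨W.starProjection, hmem⟩ : Elt M) = 0 ↔
      ∀ η, (x : H →L[ℂ] H) (W.starProjection η) = 0 := by
    constructor
    · intro h η
      exact congrArg (fun T : Elt M => (T : H →L[ℂ] H) η) h
    · intro h
      exact Subtype.ext (ContinuousLinearMap.ext h)
  rw [hx]
  constructor
  · intro h s hs
    have : s ∈ W := (hW s).2 fun y hy => hy s hs
    rw [← Submodule.starProjection_eq_self_iff.2 this]
    exact h s
  · exact fun h η => (hW _).1 (Submodule.starProjection_apply_mem W η) x h

theorem exists_projection_of_mul (a : Elt M) :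
    ∃ e : Elt M, IsStarProjection e ∧ ∀ y : Elt M, y * a = 0 ↔ y * e = 0 := by
  obtain ⟨e, he, h⟩ := exists_projection_of_set M (Set.range (a : H →L[ℂ] H))
  refine ⟨e, he, fun y => ?_⟩
  rw [h, Set.forall_mem_range]
  constructor
  · intro hy η
    exact congrArg (fun T : Elt M => (T : H →L[ℂ] H) η) hy
  · exact fun hy => Subtype.ext (ContinuousLinearMap.ext hy)

theorem seqFunctional_star_mul_self_eq_zero_iff (ζ : lp (fun _ : ℕ => H) 2) (x : Elt M) :
    seqFunctional M ζ ζ (star x * x) = 0 ↔ ∀ n, (x : H →L[ℂ] H) (ζ n) = 0 := by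
  rw [seqFunctional_apply, ← rep_norm_sq]
  simp only [ne_eq, OfNat.ofNat_ne_zero, not_false_eq_true, pow_eq_zero_iff, Complex.ofReal_eq_zero,
    norm_eq_zero]
  constructor
  · intro h n
    rw [← stdRep_apply, h]
    rfl
  · intro h
    ext n
    rw [stdRep_apply, h]
    rfl

theorem IsNormal.exists_eq_seqFunctional {φ : Elt M →ₗ[ℂ] ℂ} (hn : IsNormal φ)
    (hp : IsPositive φ) : ∃ ζ, φ = seqFunctional M ζ ζ := by
  obtain ⟨ζ, h⟩ := hn.exists_vector hp
  exact ⟨ζ, LinearMap.ext h⟩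

theorem IsNormal.exists_support {φ : Elt M →ₗ[ℂ] ℂ} (hn : IsNormal φ) (hp : IsPositive φ) :
    ∃ e : Elt M, IsStarProjection e ∧ ∀ x : Elt M, φ (star x * x) = 0 ↔ x * e = 0 := by
  obtain ⟨ζ, rfl⟩ := hn.exists_eq_seqFunctional hp
  obtain ⟨e, he, h⟩ := exists_projection_of_set M (Set.range fun n => ζ n)
  refine ⟨e, he, fun x => ?_⟩
  rw [seqFunctional_star_mul_self_eq_zero_iff, h, Set.forall_mem_range]

theorem _root_.IsStarProjection.star_mul_self {R : Type*} [Mul R] [Star R] {p : R}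
    (hp : IsStarProjection p) : star p * p = p := by
  rw [hp.isSelfAdjoint.star_eq, hp.isIdempotentElem.eq]

theorem mul_eq_zero_comm_of_isSelfAdjoint {a b : Elt M} (ha : IsSelfAdjoint a)
    (hb : IsSelfAdjoint b) (h : a * b = 0) : b * a = 0 := by
  rw [← ha.star_eq, ← hb.star_eq, ← star_mul, h, star_zero]

theorem le_of_one_sub_mul_eq_zero {p q : Elt M} (hp : IsStarProjection p)
    (hq : IsStarProjection q) (h : (1 - q) * p = 0) : p ≤ q := by
  rw [hp.le_iff_mul_eq_right hq]
  rw [sub_mul, one_mul, sub_eq_zero] at h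
  exact h.symm

/-- A self-adjoint element and its support have the same annihilator. -/
theorem isOperatorSupport_iff {a e : Elt M} :
    IsOperatorSupport a e ↔ IsStarProjection e ∧ ∀ y : Elt M, y * a = 0 ↔ y * e = 0 := by
  have key : ∀ e : Elt M, IsStarProjection e → (∀ y : Elt M, y * a = 0 ↔ y * e = 0) →
      IsOperatorSupport a e := by
    refine fun e he h => ⟨⟨he, ?_⟩, fun p hp => ?_⟩
    · have := (h (1 - e)).2 he.one_sub_mul_self
      rw [sub_mul, one_mul, sub_eq_zero] at this
      exact this.symm
    · refine le_of_one_sub_mul_eq_zero he hp.1 ((h _).1 ?_)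
      rw [sub_mul, one_mul, hp.2, sub_self]
  refine ⟨fun h => ?_, fun h => key e h.1 h.2⟩
  obtain ⟨f, hf, hfa⟩ := exists_projection_of_mul a
  rw [h.unique (key f hf hfa)]
  exact ⟨hf, hfa⟩

/-- The support of a normal positive functional determines its null left ideal. -/
theorem isFunctionalSupport_iff {φ : Elt M →ₗ[ℂ] ℂ} (hn : IsNormal φ) (hp : IsPositive φ)
    {e : Elt M} :
    IsFunctionalSupport φ e ↔
      IsStarProjection e ∧ ∀ x : Elt M, φ (star x * x) = 0 ↔ x * e = 0 := by
  have key : ∀ e : Elt M, IsStarProjection e → (∀ x : Elt M, φ (star x * x) = 0 ↔ x * e = 0) →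
      IsFunctionalSupport φ e := by
    refine fun e he h => ⟨⟨he.one_sub, ?_⟩, fun p hp => ?_⟩
    · rw [← he.one_sub.star_mul_self]
      exact (h _).2 he.one_sub_mul_self
    · have h1 := hp.2
      rw [← hp.1.star_mul_self, h] at h1
      refine hp.1.le_of_mul_eq_left he.one_sub ?_
      rw [mul_sub, mul_one, h1, sub_zero]
  refine ⟨fun h => ?_, fun h => key e h.1 h.2⟩
  obtain ⟨f, hf, hfa⟩ := hn.exists_support hp
  have h1 := IsGreatest.unique h (key f hf hfa)
  rw [sub_right_inj.1 h1]
  exact ⟨hf, hfa⟩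

/-- Conjugation by `y` gives `y a y* ≤ y b y* = 0`, and `y a y*` is `(y s*) (y s*)*` when `a = s*
s`. -/
theorem mul_eq_zero_of_le {a b y : Elt M} (ha : 0 ≤ a) (hab : a ≤ b) (h : y * b = 0) :
    y * a = 0 := by
  obtain ⟨s, rfl⟩ := CStarAlgebra.nonneg_iff_eq_star_mul_self.1 ha
  have h1 : y * (star s * s) * star y ≤ 0 := by
    simpa [h] using star_right_conjugate_le_conjugate hab y
  have h2 : (y * star s) * star (y * star s) = 0 := by
    refine le_antisymm ?_ (mul_star_self_nonneg _)
    simpa [mul_assoc] using h1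
  rw [CStarRing.mul_star_self_eq_zero_iff] at h2
  rw [← mul_assoc, h2, zero_mul]

theorem exists_mul_norm_le_pow {E : Type*} [NormedAddCommGroup E] (v : ℕ → E) :
    ∃ c : ℕ → ℝ, ∀ n, 0 < c n ∧ c n * ‖v n‖ ≤ (1 / 2) ^ n := by
  refine ⟨fun n => (1 / 2) ^ n / (1 + ‖v n‖), fun n => ⟨by positivity, ?_⟩⟩
  rw [div_mul_eq_mul_div]
  refine div_le_of_le_mul₀ (by positivity) (by positivity) ?_
  gcongr
  linarith

theorem summable_norm_sq_of_le_pow {E : Type*} [NormedAddCommGroup E] {v : ℕ → E}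
    (hv : ∀ n, ‖v n‖ ≤ (1 / 2) ^ n) : Summable fun n => ‖v n‖ ^ 2 := by
  refine Summable.of_nonneg_of_le (fun n => by positivity) (fun n => ?_)
    (summable_geometric_of_lt_one (r := 1 / 4) (by norm_num) (by norm_num))
  calc ‖v n‖ ^ 2 ≤ ((1 / 2) ^ n) ^ 2 := by gcongr; exact hv n
    _ = (1 / 4) ^ n := by rw [← pow_mul, mul_comm, pow_mul]; norm_num

/-- A `σ`-finite von Neumann algebra has a faithful normal positive functional. -/
theorem IsSigmaFinite.exists_faithful (hσ : IsSigmaFinite M) :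
    ∃ φ : Elt M →ₗ[ℂ] ℂ, IsNormal φ ∧ IsPositive φ ∧
      ∀ x : Elt M, φ (star x * x) = 0 → x = 0 := by
  let P : Elt M → Prop := fun p => IsStarProjection p ∧
    ∃ ξ : H, ∀ x : Elt M, x * p = 0 ↔ (x : H →L[ℂ] H) ξ = 0
  have hP : ∀ ξ : H, ∃ p : Elt M, IsStarProjection p ∧
      ∀ x : Elt M, x * p = 0 ↔ (x : H →L[ℂ] H) ξ = 0 := fun ξ => by
    obtain ⟨p, hp, h⟩ := exists_projection_of_set M {ξ}
    exact ⟨p, hp, fun x => by rw [h]; simp⟩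
  -- A maximal orthogonal family of cyclic projections is countable; a weighted sum of the
  -- corresponding vector states will be faithful.
  obtain ⟨T, hT⟩ := zorn_subset
    {T : Set (Elt M) | (∀ p ∈ T, P p) ∧ T.Pairwise fun p q => p * q = 0} (by
      refine fun c hc hchain => ⟨⋃₀ c, ⟨?_, ?_⟩, fun s hs => Set.subset_sUnion_of_mem hs⟩
      · rintro p ⟨t, ht, hpt⟩
        exact (hc ht).1 p hpt
      · exact (Set.pairwise_sUnion hchain.directedOn).2 fun t ht => (hc ht).2)
  obtain ⟨⟨hTP, hTpair⟩, hTmax⟩ := hT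
  -- Adding `0` makes the family nonempty, so that it is the range of a sequence.
  have hTc : (insert 0 T).Countable := by
    have h1 : (T \ {0}).Countable := hσ _ (fun p hp => ⟨(hTP p hp.1).1, hp.2⟩)
      (hTpair.mono Set.sdiff_subset)
    rw [← Set.insert_sdiff_singleton]
    exact h1.insert 0
  obtain ⟨p, hp⟩ := hTc.exists_eq_range (Set.insert_nonempty _ _)
  have hpP : ∀ n, ∃ ξ : H, ∀ x : Elt M, x * p n = 0 ↔ (x : H →L[ℂ] H) ξ = 0 := by
    intro n
    rcases (hp ▸ Set.mem_range_self n : p n ∈ insert 0 T) with h | h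
    · exact ⟨0, fun x => by simp [h]⟩
    · exact (hTP _ h).2
  choose ξ hξ using hpP
  obtain ⟨c, hc⟩ := exists_mul_norm_le_pow ξ
  have hmem : Memℓp (fun n => (c n : ℂ) • ξ n) 2 := by
    rw [memℓp_gen_iff (by norm_num)]
    simpa using summable_norm_sq_of_le_pow (v := fun n => (c n : ℂ) • ξ n) fun n => by
      rw [norm_smul, Complex.norm_real, Real.norm_of_nonneg (hc n).1.le]
      exact (hc n).2
  refine ⟨seqFunctional M ⟨_, hmem⟩ ⟨_, hmem⟩, isNormal_seqFunctional _ _,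
    isPositive_seqFunctional _, fun x hx => ?_⟩
  rw [seqFunctional_star_mul_self_eq_zero_iff] at hx
  have hxp : ∀ n, x * p n = 0 := fun n => by
    have h1 : (x : H →L[ℂ] H) ((c n : ℂ) • ξ n) = 0 := hx n
    rw [map_smul, smul_eq_zero, Complex.ofReal_eq_zero] at h1
    exact (hξ n x).2 (h1.resolve_left (hc n).1.ne')
  have hxT : ∀ q ∈ T, q * star x = 0 := fun q hq => by
    obtain ⟨n, rfl⟩ : q ∈ Set.range p := hp ▸ Set.mem_insert_of_mem _ hq
    have := congrArg star (hxp n)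
    rwa [star_mul, star_zero, (hTP _ hq).1.isSelfAdjoint.star_eq] at this
  -- Otherwise the cyclic projection of a nonzero vector in the range of `x*` is orthogonal to all
  -- of `T`. Maximality puts it into `T`, so it is orthogonal to itself.
  by_contra hx0
  obtain ⟨η, hη⟩ : ∃ η, ((star x : Elt M) : H →L[ℂ] H) η ≠ 0 := by
    by_contra! h
    exact hx0 (star_eq_zero.1 (Subtype.ext (ContinuousLinearMap.ext h)))
  obtain ⟨q, hq, hqη⟩ := hP (((star x : Elt M) : H →L[ℂ] H) η)
  have hTq : ∀ r ∈ T, r * q = 0 := fun r hr => (hqη r).2 <|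
    congrArg (fun S : Elt M => (S : H →L[ℂ] H) η) (hxT r hr)
  have hqT : q ∈ T := hTmax (y := insert q T) ⟨by
      rintro r (rfl | hr)
      · exact ⟨hq, _, hqη⟩
      · exact hTP r hr, (Set.pairwise_insert).2 ⟨hTpair, fun r hr _ =>
        ⟨mul_eq_zero_comm_of_isSelfAdjoint (hTP r hr).1.isSelfAdjoint hq.isSelfAdjoint (hTq r hr),
          hTq r hr⟩⟩⟩ (Set.subset_insert _ _) (Set.mem_insert _ _)
  have h1 := hTq q hqT
  rw [hq.isIdempotentElem.eq] at h1
  have h2 := (hqη 1).1 (by rw [h1, mul_zero])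
  exact hη h2

/-- In a `σ`-finite von Neumann algebra, a set of projections in which every sequence is bounded
above has a greatest element. -/
theorem IsSigmaFinite.exists_isGreatest (hσ : IsSigmaFinite M) {S : Set (Elt M)}
    (hS : ∀ p ∈ S, IsStarProjection p) (hne : S.Nonempty)
    (hseq : ∀ p : ℕ → Elt M, (∀ n, p n ∈ S) → ∃ q ∈ S, ∀ n, p n ≤ q) :
    ∃ e, IsGreatest S e := by
  obtain ⟨φ, -, hφp, hφ⟩ := hσ.exists_faithful
  let R : Set ℝ := (fun p => (φ p).re) '' S
  have hbdd : BddAbove R := ⟨(φ 1).re, by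
    rintro _ ⟨p, hp, rfl⟩
    exact hφp.re_mono (hS p hp).le_one⟩
  obtain ⟨u, -, hu, huS⟩ := exists_seq_tendsto_sSup (hne.image _) hbdd
  choose p hpS hpu using huS
  obtain ⟨e, heS, he⟩ := hseq p hpS
  have hemax : ∀ q ∈ S, (φ q).re ≤ (φ e).re := by
    intro q hq
    refine (le_csSup hbdd ⟨q, hq, rfl⟩).trans (le_of_tendsto' hu fun n => ?_)
    rw [← hpu n]
    exact hφp.re_mono (he n)
  refine ⟨e, heS, fun f hf => ?_⟩
  -- A common upper bound of `e` and `f`. As `e` already maximizes the faithful functional over `S`,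
  -- this bound equals `e`.
  obtain ⟨h, hhS, hh⟩ := hseq (fun n => if n = 0 then e else f) fun n => by
    split_ifs <;> assumption
  have h1 : e ≤ h := by simpa using hh 0
  have h2 : f ≤ h := by simpa using hh 1
  have h3 : IsStarProjection (h - e) := ((hS e heS).le_iff_sub (hS h hhS)).1 h1
  have h4 : h - e = 0 := by
    refine hφ _ ?_
    rw [h3.star_mul_self, hφp.eq_ofReal_re h3.nonneg, Complex.ofReal_eq_zero]
    refine le_antisymm ?_ (hφp.re_nonneg h3.nonneg)
    rw [map_sub, Complex.sub_re, sub_nonpos]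
    exact hemax h hhS
  rwa [sub_eq_zero.1 h4] at h2

end Supports
-- Maximal supports, orthogonality and the decomposition.
section Decomposition

open MeasureTheory Filter

variable {H : Type*} [NormedAddCommGroup H] [InnerProductSpace ℂ H] [CompleteSpace H]
variable {M : VonNeumannAlgebra H} {G : Type*} {α : G → (Elt M →L[ℂ] Elt M)}

/-- A `G`-invariant normal positive functional, not necessarily normalized. -/
structure IsInvariantFunctional (α : G → (Elt M →L[ℂ] Elt M)) (φ : Elt M →ₗ[ℂ] ℂ) : Prop where
  normal : IsNormal φ
  positive : IsPositive φ
  invariant : ∀ g x, φ (α g x) = φ x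

theorem IsInvariantNormalState.isInvariantFunctional [Semigroup G] {ρ : Elt M →ₗ[ℂ] ℂ}
    (hρ : IsInvariantNormalState α ρ) : IsInvariantFunctional α ρ :=
  ⟨hρ.1.normal, hρ.1.isPositive, hρ.2⟩

theorem isInvariantFunctional_zero : IsInvariantFunctional α 0 where
  normal := isNormal_iff_exists_inner.2 ⟨0, 0, fun x => by simp⟩
  positive _ _ := le_rfl
  invariant _ _ := rfl

theorem IsNormal.smul {φ : Elt M →ₗ[ℂ] ℂ} (hφ : IsNormal φ) (c : ℂ) : IsNormal (c • φ) := by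
  obtain ⟨ξ, η, h⟩ := isNormal_iff_exists_inner.1 hφ
  refine isNormal_iff_exists_inner.2 ⟨ξ, c • η, fun x => ?_⟩
  rw [LinearMap.smul_apply, h, map_smul, inner_smul_right, smul_eq_mul]

/-- Countably many invariant functionals are dominated, up to scalars, by a single one. -/
theorem exists_isInvariantFunctional_seq [Semigroup G] [TopologicalSpace G]
    (hα : IsDynamicalSystem α) {φ : ℕ → Elt M →ₗ[ℂ] ℂ} (hφ : ∀ n, IsInvariantFunctional α (φ n)) :
    ∃ ψ, IsInvariantFunctional α ψ ∧
      ∀ x : Elt M, ψ (star x * x) = 0 → ∀ n, φ n (star x * x) = 0 := by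
  choose ζ hζ using fun n => (hφ n).normal.exists_eq_seqFunctional (hφ n).positive
  obtain ⟨c, hc⟩ := exists_mul_norm_le_pow ζ
  have hσ : IsAmple (stdRep M) := isAmple_stdRep
  obtain ⟨Z, hZ⟩ := hσ (fun n => (c n : ℂ) • ζ n) (summable_norm_sq_of_le_pow fun n => by
    rw [norm_smul, Complex.norm_real, Real.norm_of_nonneg (hc n).1.le]
    exact (hc n).2)
  -- On positive elements the new functional is `∑ c n ^ 2 • φ n`, so it inherits invariance and its
  -- null elements are null for each `φ n`.
  have hsum : ∀ y : Elt M, 0 ≤ y →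
      HasSum (fun n => c n ^ 2 * (φ n y).re) (seqFunctional M Z Z y).re := by
    intro y hy
    obtain ⟨x, rfl⟩ := CStarAlgebra.nonneg_iff_eq_star_mul_self.1 hy
    have h1 : ∀ v, (seqFunctional M v v (star x * x)).re = ‖stdRep M x v‖ ^ 2 := fun v => by
      rw [seqFunctional_apply, ← rep_norm_sq, ← Complex.ofReal_pow, Complex.ofReal_re]
    rw [h1]
    convert hZ x using 2 with n
    rw [hζ n, h1, map_smul, norm_smul, Complex.norm_real, mul_pow, Real.norm_eq_abs, sq_abs]
  have hp := isPositive_seqFunctional (M := M) Z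
  refine ⟨seqFunctional M Z Z, ⟨isNormal_seqFunctional _ _, hp, fun g => ?_⟩, fun x hx n => ?_⟩
  · suffices seqFunctional M Z Z ∘ₗ (α g : Elt M →ₗ[ℂ] Elt M) = seqFunctional M Z Z from
      fun x => congrArg (fun f : Elt M →ₗ[ℂ] ℂ => f x) this
    refine linearMap_ext_of_nonneg fun y hy => ?_
    have hgy := hα.positive g y hy
    change seqFunctional M Z Z (α g y) = _
    rw [hp.eq_ofReal_re hy, hp.eq_ofReal_re hgy]
    refine congrArg _ ((hsum _ hgy).unique ?_)
    simpa only [(hφ _).invariant] using hsum y hy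
  · have h0 := star_mul_self_nonneg x
    have h1 := hsum _ h0
    rw [hx, Complex.zero_re, hasSum_zero_iff_of_nonneg fun k =>
      mul_nonneg (sq_nonneg _) ((hφ k).positive.re_nonneg h0)] at h1
    have h2 := congrFun h1 n
    rw [(hφ n).positive.eq_ofReal_re h0, Complex.ofReal_eq_zero]
    exact (mul_eq_zero.1 h2).resolve_left (pow_ne_zero _ (hc n).1.ne')

/-- Among the supports of invariant functionals there is a largest one. -/
theorem exists_isGreatest_support_functional [Semigroup G] [TopologicalSpace G]
    (hσ : IsSigmaFinite M) (hα : IsDynamicalSystem α) :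
    ∃ e : Elt M, IsGreatest {e | ∃ φ, IsInvariantFunctional α φ ∧ IsFunctionalSupport φ e} e := by
  refine hσ.exists_isGreatest ?_ ⟨0, 0, isInvariantFunctional_zero, ?_⟩ fun p hp => ?_
  · rintro p ⟨φ, hφ, hp⟩
    exact ((isFunctionalSupport_iff hφ.normal hφ.positive).1 hp).1
  · have h0 := isInvariantFunctional_zero (α := α)
    rw [isFunctionalSupport_iff h0.normal h0.positive]
    exact ⟨.zero _, fun x => by simp⟩
  · choose φ hφ hφp using hp
    obtain ⟨ψ, hψ, hψφ⟩ := exists_isInvariantFunctional_seq hα hφ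
    obtain ⟨q, hq, hψq⟩ := hψ.normal.exists_support hψ.positive
    refine ⟨q, ⟨ψ, hψ, (isFunctionalSupport_iff hψ.normal hψ.positive).2 ⟨hq, hψq⟩⟩, fun n => ?_⟩
    obtain ⟨hpn, hφn⟩ := (isFunctionalSupport_iff (hφ n).normal (hφ n).positive).1 (hφp n)
    exact le_of_one_sub_mul_eq_zero hpn hq
      ((hφn _).1 (hψφ _ ((hψq _).2 hq.one_sub_mul_self) n))

/-- A functional with largest support can be normalized unless it vanishes at `1`. In that case `e =
0`, and an invariant state would have a nonzero support below `e`. -/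
theorem exists_invariantNormalState_or [Semigroup G] {e : Elt M}
    (he : IsGreatest {e | ∃ φ, IsInvariantFunctional α φ ∧ IsFunctionalSupport φ e} e) :
    (∃ ρ, IsInvariantNormalState α ρ ∧ IsFunctionalSupport ρ e) ∨
      (e = 0 ∧ ¬ ∃ ρ, IsInvariantNormalState α ρ) := by
  obtain ⟨⟨φ, hφ, hφe⟩, hmax⟩ := he
  obtain ⟨hep, hφe⟩ := (isFunctionalSupport_iff hφ.normal hφ.positive).1 hφe
  by_cases h1 : φ 1 = 0
  · right
    have he0 : e = 0 := by simpa [h1] using hφe 1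
    refine ⟨he0, ?_⟩
    rintro ⟨ρ, hρ⟩
    have hρ' := hρ.isInvariantFunctional
    obtain ⟨f, hf, hρf⟩ := hρ'.normal.exists_support hρ'.positive
    have h2 := hmax ⟨ρ, hρ', (isFunctionalSupport_iff hρ'.normal hρ'.positive).2 ⟨hf, hρf⟩⟩
    rw [he0] at h2
    have h3 : f = 0 := le_antisymm h2 hf.nonneg
    have h4 : ρ 1 = 0 := by simpa [h3] using hρf 1
    exact one_ne_zero (hρ.1.map_one.symm.trans h4)
  · left
    have hpos : 0 ≤ (φ 1)⁻¹ := inv_nonneg.2 (hφ.positive 1 zero_le_one)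
    have hn := hφ.normal.smul (φ 1)⁻¹
    have hp : IsPositive ((φ 1)⁻¹ • φ) := fun x hx => mul_nonneg hpos (hφ.positive x hx)
    refine ⟨(φ 1)⁻¹ • φ, ⟨⟨hn, fun x => hp _ (star_mul_self_nonneg x), ?_⟩, fun g x => ?_⟩,
      (isFunctionalSupport_iff hn hp).2 ⟨hep, fun x => ?_⟩⟩
    · simp [h1]
    · simp [hφ.invariant]
    · rw [← hφe]
      simp [h1]

variable [MeasurableSpace G] {m : Measure G} {ι : Type*} [Preorder ι] {K : ι → Set G}
  {A : ι → Elt M →ₗ[ℂ] Elt M}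

theorem IsAveraging.isWeaklyWandering_iff [Semigroup G] [TopologicalSpace G]
    (hA : IsAveraging α m K A) {x : Elt M} :
    IsWeaklyWandering α m K x ↔ 0 ≤ x ∧ Tendsto (fun i => A i x) atTop (nhds 0) := by
  rw [tendsto_zero_iff_norm_tendsto_zero]
  refine and_congr_right fun _ => ⟨?_, fun h => ⟨fun i => A i x, fun i => hA.isAverage i x, h⟩⟩
  rintro ⟨B, hB, h⟩
  exact h.congr fun i => congrArg norm ((hB i).unique (hA.isAverage i x))

/-- Countably many weakly wandering operators are dominated, up to scalars, by a single one. -/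
theorem IsAveraging.exists_isWeaklyWandering_seq [Semigroup G] [TopologicalSpace G]
    (hA : IsAveraging α m K A) {x : ℕ → Elt M} (hx : ∀ n, IsWeaklyWandering α m K (x n)) :
    ∃ z, IsWeaklyWandering α m K z ∧ ∀ y : Elt M, y * z = 0 → ∀ n, y * x n = 0 := by
  obtain ⟨c, hc⟩ := exists_mul_norm_le_pow x
  have hbound : ∀ n, ‖c n • x n‖ ≤ (1 / 2) ^ n := fun n => by
    rw [norm_smul, Real.norm_of_nonneg (hc n).1.le]
    exact (hc n).2
  have hgeom : Summable fun n : ℕ => (1 / 2 : ℝ) ^ n := summable_geometric_two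
  have hsum : Summable fun n => c n • x n := Summable.of_norm_bounded hgeom hbound
  have hnn : ∀ n, 0 ≤ c n • x n := fun n => smul_nonneg (hc n).1.le (hx n).1
  refine ⟨∑' n, c n • x n, hA.isWeaklyWandering_iff.2 ⟨tsum_nonneg hnn, ?_⟩, fun y hy n => ?_⟩
  · have h1 : ∀ i, A i (∑' n, c n • x n) = ∑' n, A i (c n • x n) := fun i =>
      ((A i).mkContinuous 1 fun x => by simpa using hA.norm_le i x).map_tsum hsum
    simp only [h1]
    rw [← tsum_zero (β := ℕ)]
    -- The contractions `A i` preserve the geometric bound on the terms, so convergence term by term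
    -- suffices.
    refine tendsto_tsum_of_dominated_convergence hgeom (fun n => ?_)
      (Eventually.of_forall fun i n => (hA.norm_le i _).trans (hbound n))
    have h2 := ((hA.isWeaklyWandering_iff.1 (hx n)).2).const_smul (c n : ℂ)
    rw [smul_zero] at h2
    refine h2.congr fun i => ?_
    rw [← map_smul, Complex.coe_smul]
  · have h1 := mul_eq_zero_of_le (hnn n) (le_hasSum hsum.hasSum n fun k _ => hnn k) hy
    rw [mul_smul_comm] at h1
    exact (smul_eq_zero.1 h1).resolve_left (hc n).1.ne'

theorem IsInvariantFunctional.map_average {φ : Elt M →ₗ[ℂ] ℂ} (hφ : IsInvariantFunctional α φ)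
    {B : Set G} (hB0 : 0 < m B) (hB : m B < ∞) {x y : Elt M} (hy : IsAverage α m B x y) :
    φ y = φ x := by
  rw [hy φ hφ.normal]
  simp only [hφ.invariant]
  rw [setIntegral_const, smul_smul, inv_mul_cancel₀, one_smul]
  exact (ENNReal.toReal_pos hB0.ne' hB.ne).ne'

theorem IsInvariantFunctional.map_eq_zero [Semigroup G] [Nonempty ι] [IsDirectedOrder ι]
    {φ : Elt M →ₗ[ℂ] ℂ} (hφ : IsInvariantFunctional α φ) (hK : IsFolnerNet m K) {x : Elt M}
    (hx : IsWeaklyWandering α m K x) : φ x = 0 := by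
  obtain ⟨-, B, hB, hlim⟩ := hx
  obtain ⟨C, -, hC⟩ := hφ.normal.exists_bound
  have h1 : Tendsto (fun _ : ι => φ x) atTop (nhds 0) := by
    have h2 := hlim.const_mul C
    rw [mul_zero] at h2
    refine squeeze_zero_norm (fun i => ?_) h2
    rw [← hφ.map_average (hK.pos i) (hK.finite i) (hB i)]
    exact hC _
  exact tendsto_nhds_unique tendsto_const_nhds h1

/-- Supports of invariant functionals and of weakly wandering operators are orthogonal. -/
theorem IsInvariantFunctional.support_mul_support [Semigroup G] [Nonempty ι] [IsDirectedOrder ι]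
    {φ : Elt M →ₗ[ℂ] ℂ} (hφ : IsInvariantFunctional α φ) (hK : IsFolnerNet m K) {x e f : Elt M}
    (hx : IsWeaklyWandering α m K x) (he : IsFunctionalSupport φ e) (hf : IsOperatorSupport x f) :
    e * f = 0 := by
  have h1 := hφ.map_eq_zero hK hx
  obtain ⟨he, hφe⟩ := (isFunctionalSupport_iff hφ.normal hφ.positive).1 he
  obtain ⟨-, hxf⟩ := isOperatorSupport_iff.1 hf
  -- From `φ (s* s) = 0` follows `s e = 0`, hence `x e = 0` and, by taking adjoints, `e x = 0`.
  obtain ⟨s, rfl⟩ := CStarAlgebra.nonneg_iff_eq_star_mul_self.1 hx.1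
  refine (hxf e).1 (mul_eq_zero_comm_of_isSelfAdjoint hx.1.isSelfAdjoint he.isSelfAdjoint ?_)
  rw [mul_assoc, (hφe s).1 h1, mul_zero]

/-- `1 - e₂ = e₁` is zero or the support of an invariant state, hence orthogonal to the support `f₂`
of a weakly wandering operator. -/
theorem IsNeveuDecomposition.snd_le [Semigroup G] [Nonempty ι] [IsDirectedOrder ι]
    (hK : IsFolnerNet m K) {e₁ e₂ f₁ f₂ : Elt M} (he : IsNeveuDecomposition α m K e₁ e₂)
    (hf : IsNeveuDecomposition α m K f₁ f₂) : f₂ ≤ e₂ := by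
  refine le_of_one_sub_mul_eq_zero hf.isStarProjection_snd he.isStarProjection_snd ?_
  rw [← he.add_eq_one, add_sub_cancel_right]
  obtain ⟨x, hx, hxf⟩ := hf.wandering
  rcases he.invariant with ⟨ρ, hρ, hρe⟩ | ⟨h, -⟩
  · exact hρ.isInvariantFunctional.support_mul_support hK hx hρe hxf
  · rw [h, zero_mul]

theorem IsNeveuDecomposition.unique [Semigroup G] [Nonempty ι] [IsDirectedOrder ι]
    (hK : IsFolnerNet m K) {e₁ e₂ f₁ f₂ : Elt M} (he : IsNeveuDecomposition α m K e₁ e₂)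
    (hf : IsNeveuDecomposition α m K f₁ f₂) : f₁ = e₁ ∧ f₂ = e₂ := by
  have h : f₂ = e₂ := le_antisymm (he.snd_le hK hf) (hf.snd_le hK he)
  refine ⟨?_, h⟩
  rw [eq_sub_of_add_eq he.add_eq_one, eq_sub_of_add_eq hf.add_eq_one, h]

/-- Among the supports of weakly wandering operators there is a largest one. -/
theorem IsAveraging.exists_isGreatest_support [Semigroup G] [TopologicalSpace G]
    (hσ : IsSigmaFinite M) (hA : IsAveraging α m K A) :
    ∃ e : Elt M, IsGreatest {e | ∃ x, IsWeaklyWandering α m K x ∧ IsOperatorSupport x e} e := by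
  refine hσ.exists_isGreatest ?_ ⟨0, 0, hA.isWeaklyWandering_iff.2 ⟨le_rfl, by
      simpa using tendsto_const_nhds⟩, isOperatorSupport_iff.2 ⟨.zero _, fun y => Iff.rfl⟩⟩
    fun p hp => ?_
  · rintro p ⟨x, -, hp⟩
    exact hp.1.1
  · choose x hx hxp using hp
    obtain ⟨z, hz, hzx⟩ := hA.exists_isWeaklyWandering_seq hx
    obtain ⟨q, hq, hzq⟩ := exists_projection_of_mul z
    refine ⟨q, ⟨z, hz, isOperatorSupport_iff.2 ⟨hq, hzq⟩⟩, fun n => ?_⟩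
    obtain ⟨hpn, hxn⟩ := isOperatorSupport_iff.1 (hxp n)
    exact le_of_one_sub_mul_eq_zero hpn hq
      ((hxn _).1 (hzx _ ((hzq _).2 hq.one_sub_mul_self) n))

theorem IsAveraging.exists_isNeveuDecomposition [Semigroup G] [TopologicalSpace G] [Nonempty ι]
    [IsDirectedOrder ι] (hσ : IsSigmaFinite M) (hα : IsDynamicalSystem α) (hK : IsFolnerNet m K)
    (hA : IsAveraging α m K A) : ∃ e₁ e₂ : Elt M, IsNeveuDecomposition α m K e₁ e₂ := by
  obtain ⟨e₁, he₁⟩ := exists_isGreatest_support_functional hσ hα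
  obtain ⟨e₂, he₂⟩ := hA.exists_isGreatest_support hσ
  obtain ⟨φ, hφ, hφe⟩ := he₁.1
  obtain ⟨x, hx, hxe⟩ := he₂.1
  have he₁p := ((isFunctionalSupport_iff hφ.normal hφ.positive).1 hφe).1
  obtain ⟨he₂p, hxe'⟩ := isOperatorSupport_iff.1 hxe
  have horth : e₁ * e₂ = 0 := hφ.support_mul_support hK hx hφe hxe
  have horth' := mul_eq_zero_comm_of_isSelfAdjoint he₁p.isSelfAdjoint he₂p.isSelfAdjoint horth
  have hle : e₂ ≤ 1 - e₁ :=
    he₂p.le_of_mul_eq_left he₁p.one_sub (by rw [mul_sub, mul_one, horth', sub_zero])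
  have hp : IsStarProjection (1 - e₁ - e₂) := (he₂p.le_iff_sub he₁p.one_sub).1 hle
  have hp₁ : (1 - e₁ - e₂) * e₁ = 0 := by
    rw [sub_mul, he₁p.one_sub_mul_self, horth', sub_zero]
  have hp₂ : (1 - e₁ - e₂) * e₂ = 0 := by
    rw [sub_mul, sub_mul, one_mul, horth, he₂p.isIdempotentElem.eq, sub_zero, sub_self]
  suffices hzero : 1 - e₁ - e₂ = 0 by
    refine ⟨e₁, e₂, he₁p, he₂p, ?_, exists_invariantNormalState_or he₁, x, hx, hxe⟩
    rw [sub_sub, sub_eq_zero] at hzero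
    exact hzero.symm
  obtain ⟨ω, hωn, hωp, hω⟩ := hσ.exists_faithful
  by_contra hne
  have hωpos : 0 < (ω (1 - e₁ - e₂)).re := by
    refine lt_of_le_of_ne (hωp.re_nonneg hp.nonneg) fun h => hne (hω _ ?_)
    rw [hp.star_mul_self, hωp.eq_ofReal_re hp.nonneg, ← h, Complex.ofReal_zero]
  -- Invariant functionals have support below `e₁`, so they vanish on `1 - e₁ - e₂`. The support of
  -- the resulting `w` is below `e₂` by maximality, while `w ≤ 1 - e₁ - e₂` gives `e₂ w = 0`; hence
  -- `w = 0`.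
  obtain ⟨w, hw, hwp, hw0⟩ := hA.exists_weaklyWandering_le hα hp.nonneg (fun θ hn hθp hinv => by
    obtain ⟨f, hf, hθf⟩ := hn.exists_support hθp
    have h1 : f ≤ e₁ :=
      he₁.2 ⟨θ, ⟨hn, hθp, hinv⟩, (isFunctionalSupport_iff hn hθp).2 ⟨hf, hθf⟩⟩
    rw [← hp.star_mul_self, hθf, ← (hf.le_iff_mul_eq_right he₁p).1 h1, ← mul_assoc, hp₁, zero_mul])
    hωn hωp hωpos
  obtain ⟨f, hf, hwf⟩ := exists_projection_of_mul w
  have h1 : f ≤ e₂ := he₂.2 ⟨w, hw, isOperatorSupport_iff.2 ⟨hf, hwf⟩⟩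
  have h2 : e₂ * w = 0 := mul_eq_zero_of_le hw.1 hwp
    (mul_eq_zero_comm_of_isSelfAdjoint hp.isSelfAdjoint he₂p.isSelfAdjoint hp₂)
  have h3 : f = 0 := by
    rw [← (hf.le_iff_mul_eq_right he₂p).1 h1]
    exact (hwf _).1 h2
  refine hw0 ?_
  simpa [h3] using hwf 1

end Decomposition
end Neveu

theorem theorem3p10 {H : Type*} [NormedAddCommGroup H] [InnerProductSpace ℂ H] [CompleteSpace H]
    (M : VonNeumannAlgebra H) (hσ : Neveu.IsSigmaFinite M) (hM : Neveu.IsSemifinite M)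
    {G : Type*} [Semigroup G] [TopologicalSpace G] [ContinuousMul G] [T2Space G]
    [LocallyCompactSpace G] [SecondCountableTopology G] [MeasurableSpace G] [BorelSpace G]
    (m : MeasureTheory.Measure G) [MeasureTheory.SigmaFinite m] (hm : Neveu.IsBiinvariant m)
    {ι : Type*} [Nonempty ι] [Preorder ι] [IsDirectedOrder ι]
    [(Filter.atTop : Filter ι).IsCountablyGenerated]
    (K : ι → Set G) (hK : Neveu.IsFolnerNet m K)
    (α : G → (Neveu.Elt M →L[ℂ] Neveu.Elt M)) (hα : Neveu.IsDynamicalSystem α) :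
    ∃ e₁ e₂ : Neveu.Elt M, Neveu.IsNeveuDecomposition α m K e₁ e₂ ∧
      ∀ f₁ f₂ : Neveu.Elt M, Neveu.IsNeveuDecomposition α m K f₁ f₂ → f₁ = e₁ ∧ f₂ = e₂ := by
  obtain ⟨A, hA⟩ := Neveu.exists_isAveraging hα hm hK
  obtain ⟨e₁, e₂, he⟩ := hA.exists_isNeveuDecomposition hσ hα hK
  exact ⟨e₁, e₂, he, fun f₁ f₂ hf => he.unique hK hf⟩
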